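/- Let $0<N<L$ be integers, $\rho=N/L$, $\mathbf r_0=\rho^\rho(1-\rho)^{1-\rho}$, and let $Y=(y_1,\dots,y_N)\in\mathbb Z^N$ satisfy $y_N<\dots<y_1<y_N+L$ and $N-L\le y_j+j\le 0$ for $1\le j\le N$. Let $z\in\mathbb C$ with $0<|z|<\mathbf r_0$. Let $\mathcal L_z$ (left Bethe roots) and $\mathcal R_z$ (right Bethe roots) be the sets of roots $w$ of $w^N(w+1)^{L-N}-z^L$ with $\mathrm{Re}\,w<-\rho$ and $\mathrm{Re}\,w>-\rho$, respectively, and let $\Omega_{\mathrm L}=\{w: |w|^\rho|w+1|^{1-\rho}<\mathbf r_0,\ \mathrm{Re}\,w<-\rho\}$. Then $\mathcal R_z$ has exactly $N$ elements, and the energy function $$\mathcal E_Y(z)=\frac{\det\left[v_i^{-j}(v_i+1)^{y_j+j}\right]_{i,j=1}^N}{\det\left[v_i^{-j}\right]_{i,j=1}^N},\qquad \{v_1,\dots,v_N\}=\mathcal R_z,$$ is well defined (the denominator is nonzero and the ratio does not depend on the order of the roots). Let $(G_k)_{k\ge0}$ be the random walk on $\mathbb Z$ with $\mathbb P(G_{k+1}=x\mid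 G_k=y)=\frac{\rho}{1-\rho}(1-\rho)^{y-x}\mathbf 1_{x<y}$, let $\tau=\min\{m\ge0: G_m>y_{m+1}\}$ (only the event $\tau<N$ matters), and put $$\mathrm{ch}_Y(v,u)=\sum_{x\in\mathbb Z}\frac{(1+u)^x}{(1-\rho)^x}\,\mathbb E_{G_0=x}\left[\frac{(1-\rho)^{G_\tau}}{(1+v)^{G_\tau+1}}\left(\frac{-v}{1+v}\cdot\frac{1-\rho}{\rho}\right)^{\tau}\mathbf 1_{\tau<N}\right].$$ Let $\Gamma_{\mathrm L}$ be any piecewise $C^1$, positively oriented, simple closed contour inside $\Omega_{\mathrm L}$ enclosing all points of $\mathcal L_z$, and let $0<r<\rho$. For $x,y\in\mathbb Z_-=\{0,-1,-2,\dots\}$ define $$K^{\mathrm{en}}_Y(x,y)=\oint_{|v|=r}\frac{\mathrm dv}{2\pi\mathrm i}\int_{\Gamma_{\mathrm L}}\frac{\mathrm du}{2\pi\mathrm i}\,\frac{u^N(u+1)^{L-N-x}}{v^N(v+1)^{L-N-y+1}}\cdot\frac{z^L}{u^N(u+1)^{L-N}-z^L}\cdot\mathrm{ch}_Y(v,u).$$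 Then for all $|v|=r$ and $u\in\Gamma_{\mathrm L}$ the expectations and the series defining $\mathrm{ch}_Y(v,u)$ converge absolutely (with the convention $0^0=1$ and $0^x=0$ for integers $x\ne0$ if $u=-1$), the integrals defining $K^{\mathrm{en}}_Y$ converge, the Fredholm series $$\det(I-K^{\mathrm{en}}_Y)_{\ell^2(\mathbb Z_-)}=\sum_{k\ge0}\frac{(-1)^k}{k!}\sum_{x_1,\dots,x_k\in\mathbb Z_-}\det\left[K^{\mathrm{en}}_Y(x_i,x_j)\right]_{i,j=1}^k$$ converges absolutely, and $$\mathcal E_Y(z)=\frac{\prod_{v\in\mathcal R_z}\prod_{u\in\mathcal L_z}(v-u)}{\prod_{u\in\mathcal L_z}(-u)^N\cdot\prod_{v\in\mathcal R_z}(v+1)^{L-N}}\cdot\det(I-K^{\mathrm{en}}_Y)_{\ell^2(\mathbb Z_-)}.$$ -/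

import Mathlib

open MeasureTheory ProbabilityTheory Polynomial

noncomputable section

namespace PTASEP

/-- The density `ρ = N / L`. -/
def density (N L : ℕ) : ℝ := (N : ℝ) / (L : ℝ)

/-- The critical radius `r₀ = ρ ^ ρ * (1 - ρ) ^ (1 - ρ)`. -/
def critRadius (N L : ℕ) : ℝ :=
  density N L ^ density N L * (1 - density N L) ^ (1 - density N L)

/-- Configurations `y_N < ... < y_1 < y_N + L`. The index `j : Fin N` stands for the particle
with label `j + 1`. For a decreasing `Y` the bound on all pairs is the bound `y_1 < y_N + L`. -/
def configSpace (N L : ℕ) : Set (Fin N → ℤ) :=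
  {Y | StrictAnti Y ∧ ∀ i j, Y i < Y j + L}

/-! ### Bethe roots -/

/-- The Bethe polynomial `w ^ N * (w + 1) ^ (L - N) - z ^ L`. -/
def bethePoly (N L : ℕ) (z : ℂ) : ℂ[X] :=
  X ^ N * (X + 1) ^ (L - N) - C (z ^ L)

/-- The set of roots of the Bethe polynomial. -/
def betheRoots (N L : ℕ) (z : ℂ) : Finset ℂ := (bethePoly N L z).roots.toFinset

/-- The left Bethe roots. -/
def leftRoots (N L : ℕ) (z : ℂ) : Finset ℂ :=
  (betheRoots N L z).filter fun w => w.re < -density N L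

/-- The right Bethe roots. -/
def rightRoots (N L : ℕ) (z : ℂ) : Finset ℂ :=
  (betheRoots N L z).filter fun w => -density N L < w.re

/-- The region enclosed by the left loop of the level curve
`‖w‖ ^ ρ * ‖w + 1‖ ^ (1 - ρ) = r₀`. -/
def leftRegion (N L : ℕ) : Set ℂ :=
  {w | ‖w‖ ^ density N L * ‖w + 1‖ ^ (1 - density N L) < critRadius N L ∧
    w.re < -density N L}

/-! ### The energy function -/

/-- `det [w_i ^ (-j) * (w_i + 1) ^ λ_j] / det [w_i ^ (-j)]`, with `i, j = 1, ..., N`. -/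
def symG {N : ℕ} (lam : Fin N → ℤ) (w : Fin N → ℂ) : ℂ :=
  (Matrix.of fun i j : Fin N => w i ^ (-((j : ℤ) + 1)) * (w i + 1) ^ lam j).det /
    (Matrix.of fun i j : Fin N => w i ^ (-((j : ℤ) + 1))).det

/-- `λ(Y) = (y_1 + 1, ..., y_N + N)`. -/
def shifted {N : ℕ} (Y : Fin N → ℤ) : Fin N → ℤ := fun j => Y j + ((j : ℤ) + 1)

/-- The energy function `symG (λ(Y))` evaluated at the right Bethe roots, listed in some order
(`symG` is symmetric; the value is `0` by convention if there are not exactly `N` of them). -/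
def energy {N : ℕ} (L : ℕ) (Y : Fin N → ℤ) (z : ℂ) : ℂ :=
  if h : (rightRoots N L z).card = N then
    symG (shifted Y) fun i => (((rightRoots N L z).equivFinOfCardEq h).symm i : ℂ)
  else 0

/-! ### The geometric random walk and its hitting expectation -/

/-- The law of the increments: independent geometric variables `ξ_0, ξ_1, ...` on `{0, 1, ...}`
with `P(ξ = n) = (1 - ρ) ^ n * ρ`, for a real parameter `ρ ∈ (0, 1)`. -/
def stepLaw (ρ : ℝ) : Measure (ℕ → ℕ) :=
  Measure.infinitePi fun _ : ℕ => geometricMeasure (Set.projIcc (0 : ℝ) 1 zero_le_one ρ)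

/-- The walk started at `x` with steps `-(ξ_i + 1)`. Under `stepLaw ρ` it is the Markov chain
with transition probabilities `ρ / (1 - ρ) * (1 - ρ) ^ (b - a)` from `b` to `a < b`. -/
def walk (x : ℤ) (ξ : ℕ → ℕ) (k : ℕ) : ℤ := x - ∑ i ∈ Finset.range k, ((ξ i : ℤ) + 1)

/-- The first `m < N` at which the walk is strictly above `y_{m+1}`; it is `⊤` if there is
none. Only the event that it is smaller than `N` is ever used. -/
def hitTime {N : ℕ} (Y : Fin N → ℤ) (x : ℤ) (ξ : ℕ → ℕ) : ℕ∞ :=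
  ⨅ (m : Fin N) (_ : Y m < walk x ξ m), ((m : ℕ) : ℕ∞)

/-- The random variable
`(1-ρ)^{G_τ} / (1+v)^{G_τ+1} * ((-v)/(1+v) * (1-ρ)/ρ)^τ * 1_{τ < N}` with `G_0 = x`. -/
def hitWeight {N : ℕ} (ρ : ℝ) (Y : Fin N → ℤ) (v : ℂ) (x : ℤ) (ξ : ℕ → ℕ) : ℂ :=
  if hitTime Y x ξ < (N : ℕ∞) then
    (1 - (ρ : ℂ)) ^ walk x ξ (hitTime Y x ξ).toNat /
        (1 + v) ^ (walk x ξ (hitTime Y x ξ).toNat + 1) *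
      (-v / (1 + v) * ((1 - (ρ : ℂ)) / (ρ : ℂ))) ^ (hitTime Y x ξ).toNat
  else 0

/-- The summand of `ch` at the starting point `x`. -/
def chTerm {N : ℕ} (ρ : ℝ) (Y : Fin N → ℤ) (v u : ℂ) (x : ℤ) : ℂ :=
  (1 + u) ^ x / (1 - (ρ : ℂ)) ^ x * ∫ ξ, hitWeight ρ Y v x ξ ∂(stepLaw ρ)

/-- The hitting expectation function `ch_Y(v, u)`. -/
def ch {N : ℕ} (ρ : ℝ) (Y : Fin N → ℤ) (v u : ℂ) : ℂ := ∑' x : ℤ, chTerm ρ Y v u x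

/-! ### Contours -/

/-- The `1`-form `f(w) dw`. -/
def form (f : ℂ → ℂ) (w : ℂ) : ℂ →L[ℂ] ℂ := f w • ContinuousLinearMap.id ℂ ℂ

/-- `(2πi)⁻¹ ∫_γ f(w) dw`. -/
def contourIntegral {c d : ℂ} (γ : Path c d) (f : ℂ → ℂ) : ℂ :=
  (2 * Real.pi * Complex.I)⁻¹ * curveIntegral (form f) γ

/-- A path that is `C¹` on each interval of a finite partition of `[0, 1]`. -/
def PiecewiseC1 {c d : ℂ} (γ : Path c d) : Prop :=
  ∃ (n : ℕ) (t : ℕ → ℝ), Monotone t ∧ t 0 = 0 ∧ t n = 1 ∧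
    ∀ i < n, ContDiffOn ℝ 1 γ.extend (Set.Icc (t i) (t (i + 1)))

/-- A piecewise `C¹` simple closed contour inside the left region that encloses all left Bethe
roots counterclockwise (it avoids each of them and has winding number `1` around it). -/
structure IsLeftContour (N L : ℕ) (z : ℂ) {c : ℂ} (γ : Path c c) : Prop where
  piecewiseC1 : PiecewiseC1 γ
  simple : Set.InjOn γ {t | t < 1}
  mem_region : ∀ t, γ t ∈ leftRegion N L
  avoids : ∀ u ∈ leftRoots N L z, ∀ t, γ t ≠ u
  winding : ∀ u ∈ leftRoots N L z, contourIntegral γ (fun w => (w - u)⁻¹) = 1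

/-! ### The kernel and the Fredholm determinant -/

/-- The integrand of the double contour integral that defines the kernel. -/
def kernelIntegrand {N : ℕ} (L : ℕ) (Y : Fin N → ℤ) (z : ℂ) (x y : ℤ) (v u : ℂ) : ℂ :=
  u ^ N * (u + 1) ^ ((L : ℤ) - N - x) / (v ^ N * (v + 1) ^ ((L : ℤ) - N - y + 1)) *
    (z ^ L / (u ^ N * (u + 1) ^ (L - N) - z ^ L)) * ch (density N L) Y v u

/-- The inner integral, over `u ∈ γ`. -/
def innerIntegral {N : ℕ} (L : ℕ) (Y : Fin N → ℤ) (z : ℂ) {c : ℂ} (γ : Path c c) (x y : ℤ)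
    (v : ℂ) : ℂ :=
  contourIntegral γ fun u => kernelIntegrand L Y z x y v u

/-- The nonpositive integers `{0, -1, -2, ...}`. -/
abbrev NonposInt : Type := {x : ℤ // x ≤ 0}

/-- The kernel `K_Y^en(x, y; z)`: `v` runs over the circle of radius `r` around `0`, and `u`
runs over the contour `γ`. -/
def energyKernel {N : ℕ} (L : ℕ) (Y : Fin N → ℤ) (z : ℂ) {c : ℂ} (γ : Path c c) (r : ℝ)
    (x y : NonposInt) : ℂ :=
  (2 * Real.pi * Complex.I)⁻¹ * ∮ v in C(0, r), innerIntegral L Y z γ x y v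

/-- The minor `det [K(x_i, x_j)]` of a kernel. -/
def minor {ι : Type} (K : ι → ι → ℂ) {k : ℕ} (x : Fin k → ι) : ℂ :=
  (Matrix.of fun i j => K (x i) (x j)).det

/-- Absolute convergence of the Fredholm series of a kernel on a discrete set. -/
def FredholmConverges {ι : Type} (K : ι → ι → ℂ) : Prop :=
  (∀ k : ℕ, Summable fun x : Fin k → ι => ‖minor K x‖) ∧
    Summable fun k : ℕ => (∑' x : Fin k → ι, ‖minor K x‖) / (k.factorial : ℝ)

/-- The Fredholm determinant
`det (I - K) = ∑_k (-1)^k / k! * ∑_{x_1, ..., x_k} det [K(x_i, x_j)]`. -/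
def fredholmDet {ι : Type} (K : ι → ι → ℂ) : ℂ :=
  ∑' k : ℕ, (-1) ^ k / (k.factorial : ℂ) * ∑' x : Fin k → ι, minor K x

end PTASEP

end

/-! The kernel has rank at most N, so its Fredholm determinant is an N × N determinant. Lagrange
interpolation at the L Bethe roots factors that determinant, and one factor contains the numerator
of the energy function.

Write Q(w) = w^N (w+1)^(L-N) and P = Q - z^L, and let b_j be `betheFun Y j`. Up to the factor
(1-ρ)^x, the hitting expectation started at x does not depend on ρ (`integral_hitWeight`). What
remains, `hitGen`, solves a first-order difference equation in x with a single jump at y_1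
(`hitGen_succ`). Summing against (1+u)^x and inducting on the number of particles gives ch = -∑
b_k(u) φ_k(v) + v^N b_N(u) R(v)/(v-u) (`hasSum_hitGen`), where the φ_k, called `dualFun`, are
biorthogonal to the b_j on |v| = r (`circleMean_betheFun_dualFun`). The v^N in the last term cancels
the pole of the kernel at v = 0, so this term integrates to zero. The u-integral is a sum of
residues at the left roots, and the kernel becomes a sum of N products (`energyKernel_eq`).

The bound |z| < r₀ puts the right roots in the disc |w| < ρ and the left roots in |w+1| < 1-ρ. The
argument principle on |v| = ρ counts N right roots (`card_rightRoots`). All roots are simple,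
because P' can vanish only at 0, -1 and -ρ.

Let ℓ_k(p) be the mean of p φ_k / Q over |v| = r (`dualPairing`). By the bounds on the labels the
numerators p_j = Q b_j are polynomials of degree below L, and ℓ_k(p_j) = δ_jk. Interpolating p_j at
all Bethe roots therefore writes the identity matrix as a sum over left roots plus a sum over right
roots. The left part is exactly the Gram matrix G of the rank-N kernel, so det(1 - G) is the
determinant of the right part (`fredholm_energyKernel`). That part is the product of
`pairingMatrix`, made of ℓ_k on the Lagrange basis at the right roots, and the matrix (p_j(v_i)).
The second determinant is ∏ Q(v_i) times the numerator of the energy. The first is found by testing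
on polynomials that vanish at all left roots, on which the ℓ_k are triangular
(`det_pairingMatrix_mul`). -/

noncomputable section

namespace PTASEP

/-! ### Fredholm determinants of kernels of finite rank -/

/-- Sums of products over a finite power of the index set factorize. -/
theorem hasSum_pi_prod {ι : Type} : ∀ {k : ℕ} (g : Fin k → ι → ℂ),
    (∀ i, Summable fun x => ‖g i x‖) →
    (Summable fun x : Fin k → ι => ‖∏ i, g i (x i)‖) ∧
      HasSum (fun x : Fin k → ι => ∏ i, g i (x i)) (∏ i, ∑' x, g i x)
  | 0, g, _ => by
    exact ⟨(hasSum_fintype _).summable, by simp⟩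
  | k + 1, g, hg => by
    obtain ⟨h1, h2⟩ := hasSum_pi_prod (fun i => g i.succ) fun i => hg i.succ
    have hs := Summable.mul_norm (hg 0) h1
    have hm := (hg 0).of_norm.hasSum.mul h2 hs.of_norm
    let e : ι × (Fin k → ι) ≃ (Fin (k + 1) → ι) := Fin.consEquiv fun _ => ι
    have he : (fun x : Fin (k + 1) → ι => ∏ i, g i (x i)) ∘ e =
        fun p => g 0 p.1 * ∏ i : Fin k, g i.succ (p.2 i) := by
      funext p
      simp [e, Fin.prod_univ_succ, Fin.consEquiv]
    constructor
    · rw [← e.summable_iff]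
      convert! hs using 1
      funext p
      exact congrArg norm (congrFun he p)
    · rw [← e.hasSum_iff, he, Fin.prod_univ_succ]
      exact hm

/-- The sum of the minors of `G` along all maps `Fin k → κ` counts every principal minor of
size `k` exactly `k!` times. -/
theorem sum_det_submatrix {κ : Type*} [Fintype κ] [DecidableEq κ] (G : Matrix κ κ ℂ) (k : ℕ) :
    ∑ f : Fin k → κ, (G.submatrix f f).det =
      (k.factorial : ℂ) * ∑ s ∈ Finset.univ.powersetCard k,
        (G.submatrix (Subtype.val : s → κ) (Subtype.val : s → κ)).det := by
  classical
  have h0 : ∑ f : Fin k → κ, (G.submatrix f f).det =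
      ∑ f : Fin k → κ with Function.Injective f, (G.submatrix f f).det := by
    rw [Finset.sum_filter]
    refine Finset.sum_congr rfl fun f _ => ?_
    split_ifs with hf
    · rfl
    · simp only [Function.Injective, not_forall] at hf
      obtain ⟨a, b, hab, hne⟩ := hf
      exact Matrix.det_zero_of_row_eq hne (by ext j; simp [hab])
  rw [h0, ← Finset.sum_fiberwise_of_maps_to
    (g := fun f : Fin k → κ => Finset.univ.image f) (t := Finset.univ.powersetCard k),
    Finset.mul_sum]
  · refine Finset.sum_congr rfl fun s hs => ?_
    have hcard : s.card = k := (Finset.mem_powersetCard.mp hs).2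
    have hval : ∀ f ∈ (Finset.univ.filter fun f : Fin k → κ => Function.Injective f).filter
        (fun f => Finset.univ.image f = s), (G.submatrix f f).det =
        (G.submatrix (Subtype.val : s → κ) (Subtype.val : s → κ)).det := by
      intro f hf
      simp only [Finset.mem_filter, Finset.mem_univ, true_and] at hf
      have hmem : ∀ i, f i ∈ s := fun i => hf.2 ▸ Finset.mem_image_of_mem f (Finset.mem_univ i)
      have hbij : Function.Bijective fun i : Fin k => (⟨f i, hmem i⟩ : s) := by
        rw [Fintype.bijective_iff_injective_and_card]
        exact ⟨fun a b h => hf.1 (congrArg Subtype.val h), by simp [hcard]⟩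
      rw [← Matrix.det_submatrix_equiv_self (Equiv.ofBijective _ hbij)]
      rfl
    rw [Finset.sum_congr rfl hval, Finset.sum_const, nsmul_eq_mul]
    congr 2
    -- Injective maps with image `s` are the bijections onto `s`, so there are k! of them.
    have e : {f // f ∈ (Finset.univ.filter fun f : Fin k → κ => Function.Injective f).filter
        (fun f => Finset.univ.image f = s)} ≃ (Fin k ≃ s) :=
      { toFun := fun f => Equiv.ofBijective
          (fun i => ⟨f.1 i, by
            have := Finset.mem_image_of_mem f.1 (Finset.mem_univ i)
            rwa [(Finset.mem_filter.mp f.2).2] at this⟩) (by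
            rw [Fintype.bijective_iff_injective_and_card]
            refine ⟨fun a b h => ?_, by simp [hcard]⟩
            have := (Finset.mem_filter.mp (Finset.mem_filter.mp f.2).1).2
            exact this (congrArg Subtype.val h))
        invFun := fun e => ⟨fun i => (e i : κ), by
          simp only [Finset.mem_filter, Finset.mem_univ, true_and]
          refine ⟨fun a b h => e.injective (Subtype.ext h), ?_⟩
          ext x
          simp only [Finset.mem_image, Finset.mem_univ, true_and]
          exact ⟨fun ⟨i, hi⟩ => by rw [← hi]; exact (e i).2, fun hx => ⟨e.symm ⟨x, hx⟩, by simp⟩⟩⟩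
        left_inv := fun f => rfl
        right_inv := fun e => by ext i; rfl }
    rw [← Fintype.card_coe, Fintype.card_congr e,
      Fintype.card_equiv (finCongr hcard.symm |>.trans s.equivFin.symm)]
    simp
  · intro f hf
    simp only [Finset.mem_filter, Finset.mem_univ, true_and] at hf
    simp [Finset.mem_powersetCard, Finset.card_image_of_injective _ hf]

/-- The Fredholm expansion of the determinant of a finite matrix. -/
theorem det_one_sub_eq_sum {κ : Type*} [Fintype κ] [DecidableEq κ] (G : Matrix κ κ ℂ) :
    (1 - G).det = ∑ k ∈ Finset.range (Fintype.card κ + 1),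
      (-1) ^ k / (k.factorial : ℂ) * ∑ f : Fin k → κ, (G.submatrix f f).det := by
  -- The coefficients of det(1 - X G) are the signed sums of principal minors; evaluation at 1 adds
  -- them up.
  have h1 : (1 - G).det = ((1 + (X : ℂ[X]) • (-G).map C).det).eval 1 := by
    rw [← coe_evalRingHom, RingHom.map_det]
    congr 1
    ext i j
    simp [Matrix.one_apply, sub_eq_add_neg]
    split_ifs <;> simp
  have hdeg : ((1 + (X : ℂ[X]) • (-G).map C).det).natDegree < Fintype.card κ + 1 := by
    have := natDegree_det_X_add_C_le (-G) (1 : Matrix κ κ ℂ)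
    rw [add_comm] at this
    have h2 : (1 : Matrix κ κ ℂ).map (C : ℂ → ℂ[X]) = 1 := by
      simp [Matrix.map_one]
    rw [h2] at this
    omega
  rw [h1, eval_eq_sum_range' hdeg]
  refine Finset.sum_congr rfl fun k _ => ?_
  rw [Matrix.coeff_det_one_add_X_smul_eq_sum_minors, sum_det_submatrix, one_pow, mul_one,
    ← mul_assoc, div_mul_cancel₀ _ (Nat.cast_ne_zero.mpr k.factorial_ne_zero), Finset.mul_sum]
  refine Finset.sum_congr rfl fun s hs => ?_
  rw [Matrix.submatrix_neg, Pi.neg_apply, Pi.neg_apply, Matrix.det_neg, Fintype.card_coe,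
    (Finset.mem_powersetCard.mp hs).2]

/-- The minors of a kernel of finite rank are summable, with explicit sum. -/
theorem minor_finiteRank {ι κ : Type} [Fintype κ] [DecidableEq κ] (a b : κ → ι → ℂ)
    (h : ∀ k l, Summable fun x => ‖b k x * a l x‖) (n : ℕ) :
    (Summable fun x : Fin n → ι => ‖minor (fun x y => ∑ k, a k x * b k y) x‖) ∧
      HasSum (fun x : Fin n → ι => minor (fun x y => ∑ k, a k x * b k y) x)
        (∑ f : Fin n → κ,
          ((Matrix.of fun k l => ∑' x, b k x * a l x).submatrix f f).det) := by
  classical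
  set G : Matrix κ κ ℂ := Matrix.of fun k l => ∑' x, b k x * a l x with hG
  have hmin : ∀ x : Fin n → ι, minor (fun x y => ∑ k, a k x * b k y) x =
      ∑ f : Fin n → κ, ∑ σ : Equiv.Perm (Fin n),
        ((Equiv.Perm.sign σ : ℤ) : ℂ) * ∏ i, (b (f i) (x i) * a (f (σ⁻¹ i)) (x i)) := by
    intro x
    rw [minor, Matrix.det_apply', Finset.sum_comm]
    refine Finset.sum_congr rfl fun σ _ => ?_
    rw [← Finset.mul_sum]
    congr 1
    simp only [Matrix.of_apply]
    rw [Fintype.prod_sum]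
    refine Finset.sum_congr rfl fun f _ => ?_
    rw [Finset.prod_mul_distrib, Finset.prod_mul_distrib, mul_comm]
    congr 1
    -- Moving the `a`-factors along σ collects all factors that depend on the same `x i`, so that
    -- the sum over `x` factorizes.
    rw [← Equiv.prod_comp σ (fun i => a (f (σ⁻¹ i)) (x i))]
    simp
  have hterm : ∀ (f : Fin n → κ) (σ : Equiv.Perm (Fin n)), _ :=
    fun f σ => hasSum_pi_prod (fun i x => b (f i) x * a (f (σ⁻¹ i)) x) fun i => h _ _
  constructor
  · simp_rw [hmin]
    refine Summable.of_nonneg_of_le (fun _ => norm_nonneg _) (fun x => norm_sum_le _ _) ?_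
    refine summable_sum fun f _ => ?_
    refine Summable.of_nonneg_of_le (fun _ => norm_nonneg _) (fun x => norm_sum_le _ _) ?_
    refine summable_sum fun σ _ => ?_
    simp only [norm_mul]
    refine Summable.mul_left _ ?_
    simpa only [norm_mul] using (hterm f σ).1
  · simp_rw [hmin]
    refine hasSum_sum fun f _ => ?_
    have : (G.submatrix f f).det = ∑ σ : Equiv.Perm (Fin n),
        ((Equiv.Perm.sign σ : ℤ) : ℂ) * ∏ i, ∑' x, b (f i) x * a (f (σ⁻¹ i)) x := by
      rw [Matrix.det_apply']
      refine Finset.sum_congr rfl fun σ _ => ?_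
      congr 1
      rw [← Equiv.prod_comp σ (fun i => ∑' x, b (f i) x * a (f (σ⁻¹ i)) x)]
      simp [hG]
    rw [this]
    exact hasSum_sum fun σ _ => (hterm f σ).2.mul_left _

/-- The matrix of the minor factors through κ, so its rank is below its size. This makes the
Fredholm series a finite sum. -/
theorem minor_finiteRank_eq_zero {ι κ : Type} [Fintype κ] (a b : κ → ι → ℂ)
    {n : ℕ} (hn : Fintype.card κ < n) (x : Fin n → ι) :
    minor (fun x y => ∑ k, a k x * b k y) x = 0 := by
  classical
  rw [minor]
  by_contra hdet
  have hmul : (Matrix.of fun i j : Fin n => ∑ k, a k (x i) * b k (x j)) =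
      (Matrix.of fun (i : Fin n) k => a k (x i)) * Matrix.of fun k (j : Fin n) => b k (x j) := by
    ext i j
    simp [Matrix.mul_apply]
  have h1 := Matrix.rank_of_isUnit _ ((Matrix.isUnit_iff_isUnit_det _).mpr (IsUnit.mk0 _ hdet))
  rw [hmul] at h1
  have h2 := Matrix.rank_mul_le_left (Matrix.of fun (i : Fin n) k => a k (x i))
    (Matrix.of fun k (j : Fin n) => b k (x j))
  have h3 := Matrix.rank_le_card_width (Matrix.of fun (i : Fin n) k => a k (x i))
  simp only [Fintype.card_fin] at h1
  omega

/-- This is det(I - AB) = det(I - BA) with an infinite index set on the left: both sides expand into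
the same sums over maps `Fin k → κ`. -/
theorem fredholm_finiteRank {ι κ : Type} [Fintype κ] [DecidableEq κ] (K : ι → ι → ℂ)
    (a b : κ → ι → ℂ) (hK : ∀ x y, K x y = ∑ k, a k x * b k y)
    (h : ∀ k l, Summable fun x => ‖b k x * a l x‖) :
    FredholmConverges K ∧
      fredholmDet K = (1 - Matrix.of fun k l => ∑' x, b k x * a l x).det := by
  obtain rfl : K = fun x y => ∑ k, a k x * b k y := by
    funext x y
    exact hK x y
  refine ⟨⟨fun k => (minor_finiteRank a b h k).1, ?_⟩, ?_⟩
  · refine summable_of_ne_finset_zero (s := Finset.range (Fintype.card κ + 1)) fun k hk => ?_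
    have hk' : Fintype.card κ < k := by
      simp only [Finset.mem_range] at hk
      omega
    simp [minor_finiteRank_eq_zero a b hk']
  · rw [det_one_sub_eq_sum, fredholmDet]
    rw [tsum_eq_sum (s := Finset.range (Fintype.card κ + 1))]
    · refine Finset.sum_congr rfl fun k _ => ?_
      rw [(minor_finiteRank a b h k).2.tsum_eq]
    · intro k hk
      have hk' : Fintype.card κ < k := by
        simp only [Finset.mem_range] at hk
        omega
      simp [minor_finiteRank_eq_zero a b hk']

/-! ### The generating function of the hitting problem -/

/-- The hitting expectation without the normalization by `(1 - ρ) ^ x`. Here `B` is any lower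
bound of the configuration; it makes the sum over the first step finite. -/
def hitGen (B : ℤ) (v : ℂ) : ∀ n : ℕ, (Fin n → ℤ) → ℤ → ℂ
  | 0, _, _ => 0
  | n + 1, Y, x =>
    if Y 0 < x then (1 + v) ^ (-x - 1)
    else -v / (1 + v) * ∑ x' ∈ Finset.Ico B x, hitGen B v n (Fin.tail Y) x'

/-- The functions dual to `betheFun Y j`. -/
def dualFun (B : ℤ) (v : ℂ) : ∀ n : ℕ, (Fin n → ℤ) → Fin n → ℂ
  | 0, _ => fun k => k.elim0
  | n + 1, Y =>
    Fin.cons ((1 + v) ^ (-Y 0 - 1) - hitGen B v (n + 1) Y (Y 0))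
      fun k => v / (1 + v) * dualFun B v n (Fin.tail Y) k

/-- The entries `w ^ (-j) * (w + 1) ^ (y_j + j)` of the energy determinant. -/
def betheFun {n : ℕ} (Y : Fin n → ℤ) (j : Fin n) (w : ℂ) : ℂ :=
  w ^ (-((j : ℤ) + 1)) * (w + 1) ^ (Y j + ((j : ℤ) + 1))

theorem dualFun_zero (B : ℤ) (v : ℂ) {n : ℕ} (Y : Fin (n + 1) → ℤ) :
    dualFun B v (n + 1) Y 0 = (1 + v) ^ (-Y 0 - 1) - hitGen B v (n + 1) Y (Y 0) := by
  rw [dualFun, Fin.cons_zero]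

theorem dualFun_succ (B : ℤ) (v : ℂ) {n : ℕ} (Y : Fin (n + 1) → ℤ) (k : Fin n) :
    dualFun B v (n + 1) Y k.succ = v / (1 + v) * dualFun B v n (Fin.tail Y) k := by
  rw [dualFun, Fin.cons_succ]

theorem hitGen_of_lt (B : ℤ) (v : ℂ) {n : ℕ} {Y : Fin (n + 1) → ℤ} {x : ℤ} (h : Y 0 < x) :
    hitGen B v (n + 1) Y x = (1 + v) ^ (-x - 1) := by
  rw [hitGen, if_pos h]

theorem hitGen_of_le (B : ℤ) (v : ℂ) {n : ℕ} {Y : Fin (n + 1) → ℤ} {x : ℤ} (h : x ≤ Y 0) :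
    hitGen B v (n + 1) Y x =
      -v / (1 + v) * ∑ x' ∈ Finset.Ico B x, hitGen B v n (Fin.tail Y) x' := by
  rw [hitGen, if_neg (not_lt.mpr h)]

theorem hitGen_eq_zero (B : ℤ) (v : ℂ) {n : ℕ} {Y : Fin n → ℤ} (hB : ∀ i, B ≤ Y i) {x : ℤ}
    (h : x ≤ B) : hitGen B v n Y x = 0 := by
  cases n with
  | zero => rfl
  | succ n => simp [hitGen_of_le B v (h.trans (hB 0)), h]

theorem hitGen_succ_of_le (B : ℤ) (v : ℂ) {n : ℕ} {Y : Fin (n + 1) → ℤ} (hB : ∀ i, B ≤ Y i)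
    {x : ℤ} (h : x < Y 0) :
    hitGen B v (n + 1) Y (x + 1) =
      hitGen B v (n + 1) Y x + -v / (1 + v) * hitGen B v n (Fin.tail Y) x := by
  rw [hitGen_of_le B v (x := x + 1) (by omega), hitGen_of_le B v h.le]
  by_cases hx : B ≤ x
  · rw [← Finset.insert_Ico_right_eq_Ico_add_one hx, Finset.sum_insert (by simp)]
    ring
  · have h0 : hitGen B v n (Fin.tail Y) x = 0 :=
      hitGen_eq_zero B v (fun i => hB i.succ) (by omega)
    rw [h0, Finset.Ico_eq_empty (by omega), Finset.Ico_eq_empty (by omega)]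
    simp

/-- The value at an immediate hit solves the difference equation of `hitGen` with itself as the
source term. -/
theorem pow_walk_step {v : ℂ} (hv : 1 + v ≠ 0) (x : ℤ) :
    (1 + v) ^ (-(x + 1) - 1) = (1 + v) ^ (-x - 1) + -v / (1 + v) * (1 + v) ^ (-x - 1) := by
  rw [show -(x + 1) - 1 = (-x - 1) - 1 by ring, zpow_sub_one₀ hv]
  field_simp
  ring

/-- Below `Y 0` the sum over the first step gains one point. Above it, `hitGen` for `Y` and for its
tail are the same power, since the tail starts lower, and `pow_walk_step` applies. Only the mismatch
of the two regimes at `Y 0` survives; it is the first dual function. -/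
theorem hitGen_succ {n : ℕ} (B : ℤ) {v : ℂ} (hv : 1 + v ≠ 0) {Y : Fin (n + 2) → ℤ}
    (hY : StrictAnti Y) (hB : ∀ i, B ≤ Y i) (x : ℤ) :
    hitGen B v (n + 2) Y (x + 1) - hitGen B v (n + 2) Y x =
      -v / (1 + v) * hitGen B v (n + 1) (Fin.tail Y) x +
        if x = Y 0 then (1 + v) ^ (-Y 0 - 1) - hitGen B v (n + 2) Y (Y 0) else 0 := by
  have h01 : Fin.tail Y 0 < Y 0 := hY (by simp)
  rcases lt_trichotomy x (Y 0) with h | h | h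
  · rw [hitGen_succ_of_le B v hB h, if_neg h.ne]
    ring
  · subst h
    rw [hitGen_of_lt B v (x := Y 0 + 1) (by omega), if_pos rfl, hitGen_of_lt B v h01,
      pow_walk_step hv]
    ring
  · rw [hitGen_of_lt B v h, hitGen_of_lt B v (x := x + 1) (by omega), if_neg h.ne',
      hitGen_of_lt B v (h01.trans h), pow_walk_step hv]
    ring

/-- A two-sided series that vanishes far to the left and is geometric far to the right. -/
theorem hasSum_geometric_int {s t : ℂ} (hs0 : s ≠ 0) (ht0 : t ≠ 0) (hst : ‖s‖ < ‖t‖) (a : ℤ) :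
    HasSum (fun x : ℤ => if a < x then s ^ x * t ^ (-x - 1) else 0)
      (s ^ (a + 1) * t ^ (-a - 1) / (t - s)) := by
  have hinj : Function.Injective fun m : ℕ => a + 1 + (m : ℤ) := fun m n h => by
    simpa using h
  have hsub : ∀ x ∉ Set.range (fun m : ℕ => a + 1 + (m : ℤ)),
      (if a < x then s ^ x * t ^ (-x - 1) else 0) = 0 := by
    intro x hx
    rw [if_neg]
    intro h
    exact hx ⟨(x - a - 1).toNat, by simp only; omega⟩
  rw [← hinj.hasSum_iff hsub]
  have hlt : ‖s / t‖ < 1 := by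
    rw [norm_div, div_lt_one (norm_pos_iff.mpr ht0)]
    exact hst
  have hts : t - s ≠ 0 := fun h => by
    rw [sub_eq_zero.mp h] at hst
    exact lt_irrefl _ hst
  have h := (hasSum_geometric_of_norm_lt_one hlt).mul_left (s ^ (a + 1) * t ^ (-a - 2))
  have hval : s ^ (a + 1) * t ^ (-a - 2) * (1 - s / t)⁻¹ =
      s ^ (a + 1) * t ^ (-a - 1) / (t - s) := by
    rw [show -a - 1 = (-a - 2) + 1 by ring, zpow_add_one₀ ht0, one_sub_div ht0, inv_div]
    ring
  rw [hval] at h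
  refine h.congr_fun fun m => ?_
  simp only [Function.comp_apply]
  rw [if_pos (by omega), zpow_add₀ hs0, zpow_natCast, div_pow,
    show -(a + 1 + (m : ℤ)) - 1 = (-a - 2) - m by ring, zpow_sub₀ ht0, zpow_natCast]
  ring

/-- The series differs from a one-sided geometric one only for `x` in the finite interval from `B`
to `Y 0`. -/
theorem summable_hitGen {n : ℕ} (B : ℤ) {v u : ℂ} (hv : 1 + v ≠ 0) (hu : 1 + u ≠ 0)
    (huv : ‖1 + u‖ < ‖1 + v‖) {Y : Fin (n + 1) → ℤ} (hB : ∀ i, B ≤ Y i) :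
    Summable fun x : ℤ => (1 + u) ^ x * hitGen B v (n + 1) Y x := by
  have h1 := (hasSum_geometric_int hu hv huv (Y 0)).summable
  have h2 : Summable fun x : ℤ => (1 + u) ^ x * hitGen B v (n + 1) Y x -
      if Y 0 < x then (1 + u) ^ x * (1 + v) ^ (-x - 1) else 0 := by
    refine summable_of_ne_finset_zero (s := Finset.Ioc B (Y 0)) fun x hx => ?_
    rw [Finset.mem_Ioc] at hx
    by_cases h : Y 0 < x
    · rw [if_pos h, hitGen_of_lt B v h, sub_self]
    · rw [if_neg h, hitGen_eq_zero B v hB (by omega), mul_zero, sub_zero]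
  simpa using h1.add h2

/-- The hitting expectation function is of finite rank, up to a term that vanishes to high
order at `v = 0`. -/
theorem hasSum_hitGen (B : ℤ) {v u : ℂ} (hv : 1 + v ≠ 0) (hu : 1 + u ≠ 0) (hu0 : u ≠ 0)
    (huv : ‖1 + u‖ < ‖1 + v‖) : ∀ {n : ℕ} {Y : Fin (n + 1) → ℤ}, StrictAnti Y → (∀ i, B ≤ Y i) →
    HasSum (fun x : ℤ => (1 + u) ^ x * hitGen B v (n + 1) Y x)
      (-∑ k, betheFun Y k u * dualFun B v (n + 1) Y k +
        v ^ (n + 1) * betheFun Y (Fin.last n) u *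
          (1 + v) ^ (-Y (Fin.last n) - (n + 1)) / (v - u))
  | 0, Y, hY, hB => by
    have hne : v - u ≠ 0 := fun h => by
      rw [sub_eq_zero.mp h] at huv
      exact lt_irrefl _ huv
    convert! hasSum_geometric_int hu hv huv (Y 0) using 1
    · funext x
      rw [hitGen]
      split_ifs <;> simp [hitGen]
    · have h0 : hitGen B v 1 Y (Y 0) = 0 := by
        rw [hitGen_of_le B v le_rfl]
        simp [hitGen]
      simp only [Fin.sum_univ_succ, Fin.sum_univ_zero, dualFun_zero, betheFun, h0]
      simp only [zero_add, Fin.last_zero, Fin.isValue, Fin.val_zero, Nat.cast_zero, sub_zero,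
        pow_one, zpow_neg, zpow_one, add_sub_add_left_eq_sub, add_comm u 1]
      field_simp
      ring
  | n + 1, Y, hY, hB => by
    have ih := hasSum_hitGen B hv hu hu0 huv (n := n) (Y := Fin.tail Y)
      (fun a b h => hY (Fin.succ_lt_succ_iff.mpr h)) fun i => hB i.succ
    set F' := (-∑ k, betheFun (Fin.tail Y) k u * dualFun B v (n + 1) (Fin.tail Y) k +
        v ^ (n + 1) * betheFun (Fin.tail Y) (Fin.last n) u *
          (1 + v) ^ (-Fin.tail Y (Fin.last n) - (n + 1)) / (v - u)) with hF'
    clear_value F'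
    have hsum := (summable_hitGen B hv hu huv hB).hasSum
    set F := ∑' x : ℤ, (1 + u) ^ x * hitGen B v (n + 2) Y x with hF
    set D := (1 + v) ^ (-Y 0 - 1) - hitGen B v (n + 2) Y (Y 0) with hD
    have hshift : HasSum (fun x : ℤ => (1 + u) ^ x * hitGen B v (n + 2) Y (x + 1))
        ((1 + u)⁻¹ * F) := by
      have := ((Equiv.addRight (1 : ℤ)).hasSum_iff.mpr hsum).mul_left (1 + u)⁻¹
      refine this.congr_fun fun x => ?_
      simp only [Function.comp_apply, Equiv.coe_addRight]
      rw [zpow_add_one₀ hu]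
      field_simp
    have h1 : HasSum (fun x : ℤ => (1 + u) ^ x *
        (hitGen B v (n + 2) Y (x + 1) - hitGen B v (n + 2) Y x)) ((1 + u)⁻¹ * F - F) := by
      refine (hshift.sub hsum).congr_fun fun x => ?_
      ring
    have h2 : HasSum (fun x : ℤ => (1 + u) ^ x *
        (hitGen B v (n + 2) Y (x + 1) - hitGen B v (n + 2) Y x))
        (-v / (1 + v) * F' + (1 + u) ^ Y 0 * D) := by
      have hd : HasSum (fun x : ℤ => if x = Y 0 then (1 + u) ^ Y 0 * D else 0)
          ((1 + u) ^ Y 0 * D) := hasSum_ite_eq _ _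
      refine ((ih.mul_left (-v / (1 + v))).add hd).congr_fun fun x => ?_
      rw [hitGen_succ B hv hY hB]
      split_ifs with h
      · subst h
        ring
      · ring
    -- The same sum is evaluated by shifting `x` and by the difference equation. This is a linear
    -- equation for `F`, solvable because u ≠ 0.
    have hkey := h1.unique h2
    have hFval : F = v / (1 + v) * ((1 + u) / u) * F' - (1 + u) ^ (Y 0 + 1) / u * D := by
      rw [zpow_add_one₀ hu]
      field_simp at hkey ⊢
      linear_combination -hkey
    have htail : ∀ k, betheFun Y (Fin.succ k) u =
        (1 + u) / u * betheFun (Fin.tail Y) k u := by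
      intro k
      simp only [betheFun, Fin.tail, Fin.val_succ, Nat.cast_add, Nat.cast_one, add_comm u 1]
      rw [show -(((k : ℕ) : ℤ) + 1 + 1) = -(((k : ℕ) : ℤ) + 1) - 1 by ring, zpow_sub_one₀ hu0,
        show Y k.succ + (((k : ℕ) : ℤ) + 1 + 1) = Y k.succ + (((k : ℕ) : ℤ) + 1) + 1 by ring,
        zpow_add_one₀ hu]
      field_simp
    convert hsum using 1
    rw [hFval, hF', Fin.sum_univ_succ, ← Fin.succ_last]
    simp only [htail, dualFun_zero, dualFun_succ]
    rw [show betheFun Y 0 u = (1 + u) ^ (Y 0 + 1) / u by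
      simp [betheFun, add_comm u 1]
      ring]
    have hS : ∑ k, (1 + u) / u * betheFun (Fin.tail Y) k u *
        (v / (1 + v) * dualFun B v (n + 1) (Fin.tail Y) k) =
        v / (1 + v) * ((1 + u) / u) *
          ∑ k, betheFun (Fin.tail Y) k u * dualFun B v (n + 1) (Fin.tail Y) k := by
      rw [Finset.mul_sum]
      refine Finset.sum_congr rfl fun k _ => ?_
      ring
    rw [hS]
    rw [show -Y (Fin.last n).succ - (((n + 1 : ℕ) : ℤ) + 1) =
      (-Fin.tail Y (Fin.last n) - ((n : ℤ) + 1)) - 1 by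
        simp only [Fin.tail]
        push_cast
        ring, zpow_sub_one₀ hv (-Fin.tail Y (Fin.last n) - ((n : ℤ) + 1)), hD]
    ring

/-! ### Biorthogonality -/

/-- `(2πi)⁻¹ ∮ g(v) dv` over the circle of radius `r` around the origin. -/
def circleMean (r : ℝ) (g : ℂ → ℂ) : ℂ := (2 * Real.pi * Complex.I)⁻¹ * ∮ v in C(0, r), g v

section circleMean

variable {r : ℝ}

theorem ne_zero_of_mem_sphere (hr0 : 0 < r) {v : ℂ} (hv : v ∈ Metric.sphere (0 : ℂ) r) :
    v ≠ 0 := by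
  rintro rfl
  simp at hv
  exact hr0.ne hv

theorem one_add_ne_zero_of_mem_ball {v : ℂ} (hv : v ∈ Metric.ball (0 : ℂ) 1) : 1 + v ≠ 0 := by
  intro h
  rw [mem_ball_zero_iff, ← norm_neg, ← eq_neg_of_add_eq_zero_left h, norm_one] at hv
  exact lt_irrefl _ hv

theorem sphere_subset_unit_ball (hr1 : r < 1) :
    Metric.sphere (0 : ℂ) r ⊆ Metric.ball 0 1 :=
  Metric.sphere_subset_closedBall.trans (Metric.closedBall_subset_ball hr1)

theorem circleMean_congr (hr0 : 0 < r) {f g : ℂ → ℂ}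
    (h : Set.EqOn f g (Metric.sphere 0 r)) : circleMean r f = circleMean r g := by
  rw [circleMean, circleMean, circleIntegral.integral_congr hr0.le h]

theorem circleMean_const_mul (a : ℂ) (f : ℂ → ℂ) :
    circleMean r (fun v => a * f v) = a * circleMean r f := by
  rw [circleMean, circleMean, circleIntegral.integral_const_mul]
  ring

theorem circleMean_add (hr0 : 0 < r) {f g : ℂ → ℂ} (hf : ContinuousOn f (Metric.sphere 0 r))
    (hg : ContinuousOn g (Metric.sphere 0 r)) :
    circleMean r (fun v => f v + g v) = circleMean r f + circleMean r g := by
  rw [circleMean, circleIntegral.integral_add (hf.circleIntegrable hr0.le)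
    (hg.circleIntegrable hr0.le), mul_add]
  rfl

theorem circleMean_sub (hr0 : 0 < r) {f g : ℂ → ℂ} (hf : ContinuousOn f (Metric.sphere 0 r))
    (hg : ContinuousOn g (Metric.sphere 0 r)) :
    circleMean r (fun v => f v - g v) = circleMean r f - circleMean r g := by
  rw [circleMean, circleIntegral.integral_sub (hf.circleIntegrable hr0.le)
    (hg.circleIntegrable hr0.le), mul_sub]
  rfl

theorem circleMean_sum (hr0 : 0 < r) {ι : Type*} (s : Finset ι) {f : ι → ℂ → ℂ}
    (hf : ∀ i ∈ s, ContinuousOn (f i) (Metric.sphere 0 r)) :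
    circleMean r (fun v => ∑ i ∈ s, f i v) = ∑ i ∈ s, circleMean r (f i) := by
  rw [circleMean, circleIntegral.integral_fun_sum fun i hi => (hf i hi).circleIntegrable hr0.le,
    Finset.mul_sum]
  rfl

theorem circleMean_eq_zero (hr0 : 0 < r) (hr1 : r < 1) {f : ℂ → ℂ}
    (hf : DifferentiableOn ℂ f (Metric.ball 0 1)) : circleMean r f = 0 := by
  have h : DiffContOnCl ℂ f (Metric.ball 0 r) :=
    (hf.mono ((Metric.closure_ball_subset_closedBall).trans
      (Metric.closedBall_subset_ball hr1))).diffContOnCl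
  rw [circleMean, h.circleIntegral_eq_zero hr0.le, mul_zero]

theorem circleMean_inv_mul (hr0 : 0 < r) (hr1 : r < 1) {f : ℂ → ℂ}
    (hf : DifferentiableOn ℂ f (Metric.ball 0 1)) :
    circleMean r (fun v => v⁻¹ * f v) = f 0 := by
  have h : DiffContOnCl ℂ f (Metric.ball 0 r) :=
    (hf.mono ((Metric.closure_ball_subset_closedBall).trans
      (Metric.closedBall_subset_ball hr1))).diffContOnCl
  have := h.two_pi_i_inv_smul_circleIntegral_sub_inv_smul (Metric.mem_ball_self hr0)
  simpa [circleMean] using this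

/-- `v ^ (-m - 2) * (1 + v) ^ m` has no residue at the origin. -/
theorem circleMean_pow_div (hr0 : 0 < r) (m : ℕ) :
    circleMean r (fun v => v ^ (-((m : ℤ) + 2)) * (1 + v) ^ m) = 0 := by
  rw [circleMean, circleIntegral.integral_eq_zero_of_hasDerivWithinAt (f := fun v : ℂ =>
    -((m : ℂ) + 1)⁻¹ * (v⁻¹ + 1) ^ (m + 1)) hr0.le, mul_zero]
  intro v hv
  have hv0 := ne_zero_of_mem_sphere hr0 hv
  have h := ((((hasDerivAt_inv hv0).add_const 1).pow (m + 1)).const_mul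
    (-((m : ℂ) + 1)⁻¹)).hasDerivWithinAt (s := Metric.sphere 0 r)
  convert! h using 1
  have hm : (m : ℂ) + 1 ≠ 0 := Nat.cast_add_one_ne_zero m
  rw [show -((m : ℤ) + 2) = -((m + 2 : ℕ) : ℤ) by push_cast; ring, zpow_neg, zpow_natCast,
    show v⁻¹ + 1 = (1 + v) / v by field_simp]
  simp only [Nat.add_sub_cancel, div_pow]
  push_cast
  field_simp
  ring

end circleMean

theorem differentiableOn_one_add_zpow (m : ℤ) :
    DifferentiableOn ℂ (fun v : ℂ => (1 + v) ^ m) (Metric.ball 0 1) := fun _ hv =>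
  (((differentiableAt_const 1).add differentiableAt_id).zpow
    (Or.inl (one_add_ne_zero_of_mem_ball hv))).differentiableWithinAt

theorem differentiableOn_inv_one_add :
    DifferentiableOn ℂ (fun v : ℂ => (1 + v)⁻¹) (Metric.ball 0 1) := by
  simpa using differentiableOn_one_add_zpow (-1)

theorem differentiableOn_hitGen (B : ℤ) : ∀ {n : ℕ} (Y : Fin n → ℤ) (x : ℤ),
    DifferentiableOn ℂ (fun v => hitGen B v n Y x) (Metric.ball 0 1)
  | 0, _, _ => differentiableOn_const 0
  | n + 1, Y, x => by
    by_cases h : Y 0 < x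
    · simp only [hitGen, if_pos h]
      exact differentiableOn_one_add_zpow _
    · simp only [hitGen, if_neg h, div_eq_mul_inv]
      exact (differentiableOn_id.neg.mul differentiableOn_inv_one_add).mul
        (DifferentiableOn.fun_sum fun x' _ => differentiableOn_hitGen B (Fin.tail Y) x')

/-- The dual functions vanish to increasing order at the origin. -/
theorem exists_dualFun_eq (B : ℤ) : ∀ {n : ℕ} (Y : Fin n → ℤ) (k : Fin n),
    ∃ ψ : ℂ → ℂ, DifferentiableOn ℂ ψ (Metric.ball 0 1) ∧ ψ 0 = 1 ∧
      ∀ v, dualFun B v n Y k = v ^ (k : ℕ) * ψ v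
  | n + 1, Y, k => by
    refine Fin.cases ?_ (fun k => ?_) k
    · refine ⟨fun v => (1 + v) ^ (-Y 0 - 1) - hitGen B v (n + 1) Y (Y 0),
        (differentiableOn_one_add_zpow _).sub (differentiableOn_hitGen B Y _), ?_, fun v => ?_⟩
      · simp [hitGen_of_le B 0 (le_refl (Y 0))]
      · simp [dualFun_zero]
    · obtain ⟨ψ, h1, h2, h3⟩ := exists_dualFun_eq B (Fin.tail Y) k
      refine ⟨fun v => (1 + v)⁻¹ * ψ v, differentiableOn_inv_one_add.mul h1, by simp [h2],
        fun v => ?_⟩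
      rw [dualFun_succ, h3, Fin.val_succ]
      ring

theorem differentiableOn_dualFun (B : ℤ) {n : ℕ} (Y : Fin n → ℤ) (k : Fin n) :
    DifferentiableOn ℂ (fun v => dualFun B v n Y k) (Metric.ball 0 1) := by
  obtain ⟨ψ, h1, -, h3⟩ := exists_dualFun_eq B Y k
  simp only [h3]
  exact (differentiableOn_id.pow _).mul h1

theorem continuousOn_betheFun {n : ℕ} (Y : Fin n → ℤ) (j : Fin n) {r : ℝ} (hr0 : 0 < r)
    (hr1 : r < 1) : ContinuousOn (betheFun Y j) (Metric.sphere 0 r) := by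
  intro v hv
  have h0 := ne_zero_of_mem_sphere hr0 hv
  have h1 : v + 1 ≠ 0 := by
    rw [add_comm]
    exact one_add_ne_zero_of_mem_ball (sphere_subset_unit_ball hr1 hv)
  exact (((continuousAt_id.zpow₀ _ (Or.inl h0))).mul
    ((continuousAt_id.add continuousAt_const).zpow₀ _ (Or.inl h1))).continuousWithinAt

theorem betheFun_zero {n : ℕ} (Y : Fin (n + 1) → ℤ) (v : ℂ) :
    betheFun Y 0 v = v⁻¹ * (1 + v) ^ (Y 0 + 1) := by
  simp [betheFun, add_comm]

theorem betheFun_succ {n : ℕ} (Y : Fin (n + 1) → ℤ) (j : Fin n) {v : ℂ} (hv : v ≠ 0)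
    (hv1 : 1 + v ≠ 0) :
    betheFun Y j.succ v * (v / (1 + v)) = betheFun (Fin.tail Y) j v := by
  simp only [betheFun, Fin.tail, Fin.val_succ, Nat.cast_add, Nat.cast_one, add_comm v 1]
  rw [show -(((j : ℕ) : ℤ) + 1 + 1) = -(((j : ℕ) : ℤ) + 1) - 1 by ring, zpow_sub_one₀ hv,
    show Y j.succ + (((j : ℕ) : ℤ) + 1 + 1) = Y j.succ + (((j : ℕ) : ℤ) + 1) + 1 by ring,
    zpow_add_one₀ hv1]
  field_simp

/-- The vanishing of `E` at a + 1 removes the lower boundary term. -/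
theorem sum_Ico_telescope (E : ℤ → ℂ) {B a : ℤ} (h : B ≤ a) (hE : E (a + 1) = 0) (x : ℤ) :
    ∑ x' ∈ Finset.Ico B x, (if a < x' then E (x' + 1) - E x' else 0) =
      if a < x then E x else 0 := by
  rcases le_total x B with hx | hx
  · rw [Finset.Ico_eq_empty (by omega), if_neg (by omega), Finset.sum_empty]
  · induction x, hx using Int.leInduction with
    | base => rw [Finset.Ico_self, if_neg (by omega), Finset.sum_empty]
    | succ x hx ih =>
      rw [← Finset.insert_Ico_right_eq_Ico_add_one hx, Finset.sum_insert (by simp), ih]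
      rcases lt_trichotomy a x with h1 | h1 | h1
      · rw [if_pos h1, if_pos h1, if_pos (by omega)]
        ring
      · subst h1
        simp [hE]
      · rw [if_neg (by omega), if_neg (by omega), if_neg (by omega), add_zero]

/-- Tested against b_j, the hitting problem forgets all particles except the j-th. One step of the
recursion lowers `j`, and the sum over the first step telescopes. -/
theorem circleMean_betheFun_hitGen (B : ℤ) {r : ℝ} (hr0 : 0 < r) (hr1 : r < 1) :
    ∀ {n : ℕ} {Y : Fin n → ℤ}, StrictAnti Y → (∀ i, B ≤ Y i) → ∀ (j : Fin n) (x : ℤ),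
    circleMean r (fun v => betheFun Y j v * hitGen B v n Y x) =
      if Y j < x then circleMean r (fun v => betheFun Y j v * (1 + v) ^ (-x - 1)) else 0
  | n + 1, Y, hY, hB, j, x => by
    by_cases hx : Y 0 < x
    · rw [if_pos ((hY.antitone (Fin.zero_le j)).trans_lt hx)]
      simp only [hitGen_of_lt B _ hx]
    rw [not_lt] at hx
    revert j
    refine Fin.cases ?_ fun j => ?_
    -- The first function has only a simple pole at 0, which the factor `v` in the recursion
    -- cancels.
    · rw [if_neg (not_lt.mpr hx)]
      rw [circleMean_congr hr0 (g := fun v => -(1 + v) ^ (Y 0 + 1) * (1 + v)⁻¹ *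
        ∑ x' ∈ Finset.Ico B x, hitGen B v n (Fin.tail Y) x')]
      · exact circleMean_eq_zero hr0 hr1 (((differentiableOn_one_add_zpow _).neg.mul
          differentiableOn_inv_one_add).mul
          (DifferentiableOn.fun_sum fun x' _ => differentiableOn_hitGen B (Fin.tail Y) x'))
      · intro v hv
        have hv0 := ne_zero_of_mem_sphere hr0 hv
        simp only [betheFun_zero, hitGen_of_le B v hx]
        field_simp
    · have hcont : ∀ x : ℤ, ContinuousOn (fun v : ℂ => (1 + v) ^ x) (Metric.sphere 0 r) :=
        fun x => (differentiableOn_one_add_zpow x).continuousOn.mono (sphere_subset_unit_ball hr1)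
      have ih := circleMean_betheFun_hitGen B hr0 hr1 (Y := Fin.tail Y)
        (fun a b h => hY (Fin.succ_lt_succ_iff.mpr h)) (fun i => hB i.succ) j
      set E : ℤ → ℂ := fun x =>
        circleMean r (fun v => betheFun Y j.succ v * (1 + v) ^ (-x - 1)) with hE
      have hEtail : ∀ x', circleMean r
          (fun v => betheFun (Fin.tail Y) j v * (1 + v) ^ (-x' - 1)) = -(E (x' + 1) - E x') := by
        intro x'
        rw [hE]
        simp only
        rw [← circleMean_sub hr0 ((continuousOn_betheFun Y _ hr0 hr1).fun_mul (hcont _))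
          ((continuousOn_betheFun Y _ hr0 hr1).fun_mul (hcont _)),
          neg_eq_neg_one_mul (circleMean r _),
          ← circleMean_const_mul]
        refine circleMean_congr hr0 fun v hv => ?_
        have hv0 := ne_zero_of_mem_sphere hr0 hv
        have hv1 := one_add_ne_zero_of_mem_ball (sphere_subset_unit_ball hr1 hv)
        rw [← betheFun_succ Y j hv0 hv1, pow_walk_step hv1]
        ring
      -- At this point the integrand is v^(-j-2) (1+v)^j, the derivative of a multiple of (1/v +
      -- 1)^(j+1), so there is no lower boundary term.
      have hE0 : E (Y j.succ + 1) = 0 := by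
        rw [← circleMean_pow_div hr0 (j : ℕ), hE]
        refine circleMean_congr hr0 fun v hv => ?_
        have hv1 := one_add_ne_zero_of_mem_ball (sphere_subset_unit_ball hr1 hv)
        simp only [betheFun, Fin.val_succ, Nat.cast_add, Nat.cast_one, add_comm v 1]
        rw [mul_assoc, ← zpow_add₀ hv1, ← zpow_natCast]
        congr 2 <;> ring
      rw [← sum_Ico_telescope E (hB j.succ) hE0 x]
      rw [circleMean_congr hr0 (g := fun v => -1 * ∑ x' ∈ Finset.Ico B x,
        betheFun (Fin.tail Y) j v * hitGen B v n (Fin.tail Y) x')]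
      · rw [circleMean_const_mul, circleMean_sum hr0]
        · rw [Finset.mul_sum]
          refine Finset.sum_congr rfl fun x' _ => ?_
          rw [ih x', hEtail]
          have ht : Fin.tail Y j = Y j.succ := rfl
          rw [ht]
          split_ifs <;> ring
        · exact fun x' _ => (continuousOn_betheFun _ _ hr0 hr1).mul
            ((differentiableOn_hitGen B _ x').continuousOn.mono (sphere_subset_unit_ball hr1))
      · intro v hv
        have hv0 := ne_zero_of_mem_sphere hr0 hv
        have hv1 := one_add_ne_zero_of_mem_ball (sphere_subset_unit_ball hr1 hv)
        simp only [hitGen_of_le B v hx, ← betheFun_succ Y j hv0 hv1]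
        rw [← Finset.mul_sum]
        ring

/-- The first dual function is the power (1+v)^(-y_1-1) minus `hitGen` at y_1. For a later b_j the
two have equal pairings, as y_j < y_1. If only the dual index is a successor, its factor `v` cancels
the simple pole of the first b. If both are, the factors cancel and the statement reduces to the
tail. -/
theorem circleMean_betheFun_dualFun (B : ℤ) {r : ℝ} (hr0 : 0 < r) (hr1 : r < 1) :
    ∀ {n : ℕ} {Y : Fin n → ℤ}, StrictAnti Y → (∀ i, B ≤ Y i) → ∀ (j k : Fin n),
    circleMean r (fun v => betheFun Y j v * dualFun B v n Y k) = if j = k then 1 else 0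
  | n + 1, Y, hY, hB, j, k => by
    have hsub := sphere_subset_unit_ball hr1
    revert j k
    refine Fin.cases (Fin.cases ?_ fun k => ?_) fun j => Fin.cases ?_ fun k => ?_
    · obtain ⟨ψ, h1, h2, h3⟩ := exists_dualFun_eq B Y 0
      rw [circleMean_congr hr0 (g := fun v => v⁻¹ * ((1 + v) ^ (Y 0 + 1) * ψ v)),
        circleMean_inv_mul hr0 hr1 ((differentiableOn_one_add_zpow _).fun_mul h1)]
      · simp [h2]
      · intro v hv
        simp only [betheFun_zero, h3]
        simp
        ring
    · rw [if_neg (Fin.succ_ne_zero k).symm, circleMean_congr hr0 (g := fun v =>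
        (1 + v) ^ (Y 0 + 1) * (1 + v)⁻¹ * dualFun B v n (Fin.tail Y) k)]
      · exact circleMean_eq_zero hr0 hr1 (((differentiableOn_one_add_zpow _).mul
          differentiableOn_inv_one_add).mul (differentiableOn_dualFun B _ k))
      · intro v hv
        have hv0 := ne_zero_of_mem_sphere hr0 hv
        simp only [betheFun_zero, dualFun_succ]
        field_simp
    · rw [if_neg (Fin.succ_ne_zero j)]
      simp only [dualFun_zero, mul_sub]
      rw [circleMean_sub hr0, circleMean_betheFun_hitGen B hr0 hr1 hY hB,
        if_pos (hY (Fin.succ_pos j)), sub_self]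
      · exact (continuousOn_betheFun _ _ hr0 hr1).mul
          ((differentiableOn_one_add_zpow _).continuousOn.mono hsub)
      · exact (continuousOn_betheFun _ _ hr0 hr1).mul
          ((differentiableOn_hitGen B _ _).continuousOn.mono hsub)
    · have ih := circleMean_betheFun_dualFun B hr0 hr1 (Y := Fin.tail Y)
        (fun a b h => hY (Fin.succ_lt_succ_iff.mpr h)) (fun i => hB i.succ) j k
      rw [show (if j.succ = k.succ then (1 : ℂ) else 0) = if j = k then 1 else 0 by
        simp only [Fin.succ_inj], ← ih]
      refine circleMean_congr hr0 fun v hv => ?_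
      rw [dualFun_succ, ← betheFun_succ Y j (ne_zero_of_mem_sphere hr0 hv)
        (one_add_ne_zero_of_mem_ball (hsub hv))]
      ring

/-! ### The hitting expectation -/

theorem walk_succ (x : ℤ) (ξ : ℕ → ℕ) (k : ℕ) :
    walk x ξ (k + 1) = walk (x - ((ξ 0 : ℤ) + 1)) (fun i => ξ (i + 1)) k := by
  rw [walk, walk, Finset.sum_range_succ']
  ring

theorem hitTime_of_lt {n : ℕ} {Y : Fin (n + 1) → ℤ} {x : ℤ} (ξ : ℕ → ℕ) (h : Y 0 < x) :
    hitTime Y x ξ = 0 := by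
  refine le_antisymm ?_ zero_le
  exact (iInf₂_le (0 : Fin (n + 1)) (by simpa [walk] using h)).trans (by simp)

/-- With no hit at time 0, the problem restarts after one step with the tail of the configuration.
Adding 1 preserves ⊤, so the event of never hitting is covered too. -/
theorem hitTime_of_le {n : ℕ} {Y : Fin (n + 1) → ℤ} {x : ℤ} (ξ : ℕ → ℕ) (h : x ≤ Y 0) :
    hitTime Y x ξ =
      hitTime (Fin.tail Y) (x - ((ξ 0 : ℤ) + 1)) (fun i => ξ (i + 1)) + 1 := by
  apply le_antisymm
  · rw [hitTime, hitTime, ENat.iInf_add]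
    refine le_iInf fun m => ?_
    rw [ENat.iInf_add]
    refine le_iInf fun hm => ?_
    refine (iInf₂_le m.succ ?_).trans (by simp)
    rw [Fin.val_succ, walk_succ]
    exact hm
  · refine le_iInf₂ fun m hm => ?_
    revert hm
    refine Fin.cases (fun hm => ?_) (fun m hm => ?_) m
    · simp [walk] at hm
      omega
    · rw [Fin.val_succ, walk_succ] at hm
      have : hitTime (Fin.tail Y) (x - ((ξ 0 : ℤ) + 1)) (fun i => ξ (i + 1)) ≤ (m : ℕ) :=
        iInf₂_le m hm
      rw [Fin.val_succ, Nat.cast_add, Nat.cast_one]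
      gcongr

theorem hitWeight_of_lt (ρ : ℝ) (v : ℂ) {n : ℕ} {Y : Fin (n + 1) → ℤ} {x : ℤ} (ξ : ℕ → ℕ)
    (h : Y 0 < x) : hitWeight ρ Y v x ξ = (1 - (ρ : ℂ)) ^ x / (1 + v) ^ (x + 1) := by
  rw [hitWeight, hitTime_of_lt ξ h, if_pos (by simp)]
  simp [walk]

theorem hitWeight_of_le (ρ : ℝ) (v : ℂ) {n : ℕ} {Y : Fin (n + 1) → ℤ} {x : ℤ} (ξ : ℕ → ℕ)
    (h : x ≤ Y 0) : hitWeight ρ Y v x ξ = -v / (1 + v) * ((1 - (ρ : ℂ)) / (ρ : ℂ)) *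
      hitWeight ρ (Fin.tail Y) v (x - ((ξ 0 : ℤ) + 1)) fun i => ξ (i + 1) := by
  rw [hitWeight, hitWeight, hitTime_of_le ξ h]
  set t := hitTime (Fin.tail Y) (x - ((ξ 0 : ℤ) + 1)) fun i => ξ (i + 1)
  by_cases ht : t < (n : ℕ∞)
  · obtain ⟨m, hm⟩ := ENat.ne_top_iff_exists.mp ht.ne_top
    rw [← hm] at ht ⊢
    have h1 : ((m : ℕ∞) + 1).toNat = m + 1 := by
      rw [← Nat.cast_one, ← Nat.cast_add, ENat.toNat_natCast]
    have h2 : (m : ℕ∞) + 1 < ((n + 1 : ℕ) : ℕ∞) := by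
      have := Nat.cast_lt.mp ht
      exact_mod_cast Nat.succ_lt_succ this
    rw [if_pos ht, if_pos h2, h1, ENat.toNat_natCast, walk_succ]
    ring
  · rw [if_neg ht, if_neg, mul_zero]
    intro h2
    apply ht
    have h3 : t ≠ ⊤ := by
      intro h4
      rw [h4] at h2
      simp at h2
    obtain ⟨m, hm⟩ := ENat.ne_top_iff_exists.mp h3
    rw [← hm] at h2 ⊢
    have h5 : m + 1 < n + 1 := by exact_mod_cast h2
    exact_mod_cast Nat.lt_of_succ_lt_succ h5

theorem hitWeight_fin_zero (ρ : ℝ) (Y : Fin 0 → ℤ) (v : ℂ) (x : ℤ) (ξ : ℕ → ℕ) :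
    hitWeight ρ Y v x ξ = 0 := by
  simp [hitWeight]

theorem measurable_uncurry_step {F : ℤ → (ℕ → ℕ) → ℂ} (hF : ∀ y, Measurable (F y)) (x : ℤ) :
    Measurable fun q : ℕ × (ℕ → ℕ) => F (x - ((q.1 : ℤ) + 1)) q.2 := by
  refine measurable_from_prod_countable_right fun k => ?_
  exact hF (x - ((k : ℤ) + 1))

theorem measurable_hitWeight (ρ : ℝ) (v : ℂ) {n : ℕ} (Y : Fin n → ℤ) (x : ℤ) :
    Measurable (hitWeight ρ Y v x) := by
  induction n generalizing x with
  | zero =>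
    have h : hitWeight ρ Y v x = fun _ => 0 := funext (hitWeight_fin_zero ρ Y v x)
    rw [h]
    exact measurable_const
  | succ n ih =>
    by_cases h : Y 0 < x
    · have h1 : hitWeight ρ Y v x = fun _ => (1 - (ρ : ℂ)) ^ x / (1 + v) ^ (x + 1) :=
        funext fun ξ => hitWeight_of_lt ρ v ξ h
      rw [h1]
      exact measurable_const
    · have h0 : hitWeight ρ Y v x = fun ξ => -v / (1 + v) * ((1 - (ρ : ℂ)) / (ρ : ℂ)) *
          hitWeight ρ (Fin.tail Y) v (x - ((ξ 0 : ℤ) + 1)) fun i => ξ (i + 1) :=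
        funext fun ξ => hitWeight_of_le ρ v ξ (not_lt.mp h)
      rw [h0]
      have h1 : Measurable fun p : ℕ × (ℕ → ℕ) =>
          hitWeight ρ (Fin.tail Y) v (x - ((p.1 : ℤ) + 1)) p.2 :=
        measurable_uncurry_step (fun y => ih (Fin.tail Y) y) x
      have h2 : Measurable fun ξ : ℕ → ℕ => (ξ 0, fun i => ξ (i + 1)) := by fun_prop
      exact (h1.comp h2).const_mul _

/-- The walk only descends, so an immediate hit happens at one of the finitely many heights in (`Y
0`, `X`], and otherwise the bound for the tail applies with the same `X`. Uniformity in x ≤ X is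
what the conditioning on an unbounded first step requires. -/
theorem exists_norm_hitWeight_le (ρ : ℝ) (v : ℂ) : ∀ {n : ℕ} (Y : Fin n → ℤ) (X : ℤ),
    ∃ C : ℝ, 0 ≤ C ∧ ∀ x ≤ X, ∀ ξ, ‖hitWeight ρ Y v x ξ‖ ≤ C
  | 0, Y, X => ⟨0, le_rfl, fun x _ ξ => by simp [hitWeight_fin_zero]⟩
  | n + 1, Y, X => by
    obtain ⟨C, hC0, hC⟩ := exists_norm_hitWeight_le ρ v (Fin.tail Y) X
    set e : ℤ → ℝ := fun x => ‖(1 - (ρ : ℂ)) ^ x / (1 + v) ^ (x + 1)‖ with he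
    have h0 : 0 ≤ ∑ x ∈ Finset.Ioc (Y 0) X, e x := Finset.sum_nonneg fun x _ => norm_nonneg _
    have h1 : 0 ≤ ‖-v / (1 + v) * ((1 - (ρ : ℂ)) / (ρ : ℂ))‖ * C :=
      mul_nonneg (norm_nonneg _) hC0
    refine ⟨_, add_nonneg h0 h1, fun x hx ξ => ?_⟩
    by_cases h : Y 0 < x
    · rw [hitWeight_of_lt ρ v ξ h]
      refine le_add_of_le_of_nonneg ?_ h1
      exact Finset.single_le_sum (f := e) (fun x _ => norm_nonneg _)
        (Finset.mem_Ioc.mpr ⟨h, hx⟩)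
    · rw [hitWeight_of_le ρ v ξ (not_lt.mp h), norm_mul]
      refine le_add_of_nonneg_of_le h0 ?_
      gcongr
      exact hC _ (by omega) _

instance isProbabilityMeasure_stepLaw (ρ : ℝ) : IsProbabilityMeasure (stepLaw ρ) := by
  unfold stepLaw
  infer_instance

theorem integrable_hitWeight (ρ : ℝ) (v : ℂ) {n : ℕ} (Y : Fin n → ℤ) (x : ℤ) :
    Integrable (hitWeight ρ Y v x) (stepLaw ρ) := by
  obtain ⟨C, -, hC⟩ := exists_norm_hitWeight_le ρ v Y x
  exact Integrable.of_bound (measurable_hitWeight ρ v Y x).aestronglyMeasurable C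
    (Filter.Eventually.of_forall fun ξ => hC x le_rfl ξ)

/-- The first step is independent of the remaining ones. -/
theorem map_prod_stepLaw (ρ : ℝ) :
    ((geometricMeasure (Set.projIcc (0 : ℝ) 1 zero_le_one ρ)).prod (stepLaw ρ)).map
      (fun p i => Nat.casesOn i p.1 p.2) = stepLaw ρ := by
  classical
  set μ := geometricMeasure (Set.projIcc (0 : ℝ) 1 zero_le_one ρ)
  have hmeas : Measurable fun (p : ℕ × (ℕ → ℕ)) (i : ℕ) =>
      (Nat.casesOn i p.1 p.2 : ℕ) := by
    refine measurable_pi_lambda _ fun i => ?_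
    cases i with
    | zero => exact measurable_fst
    | succ i => exact (measurable_pi_apply i).comp measurable_snd
  refine Measure.eq_infinitePi (fun _ : ℕ => μ) fun s t ht => ?_
  obtain ⟨m, hm⟩ : ∃ m, s ⊆ Finset.range (m + 1) := by
    obtain ⟨m, hm⟩ := s.exists_nat_subset_range
    exact ⟨m, hm.trans (Finset.range_mono (Nat.le_succ m))⟩
  -- Padding with full factors turns the cylinder into one over an initial segment, which splits
  -- into its first coordinate and the rest.
  set t' : ℕ → Set ℕ := fun i => if i ∈ s then t i else Set.univ with ht'
  have ht'm : ∀ i, MeasurableSet (t' i) := fun i => by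
    simp only [ht']
    split_ifs
    exacts [ht i, MeasurableSet.univ]
  have hprod : ∏ i ∈ s, μ (t i) = ∏ i ∈ Finset.range (m + 1), μ (t' i) := by
    rw [← Finset.prod_subset hm]
    · exact Finset.prod_congr rfl fun i hi => by simp [ht', hi]
    · intro i _ hi
      simp [ht', hi]
  have hset : (fun (p : ℕ × (ℕ → ℕ)) (i : ℕ) => (Nat.casesOn i p.1 p.2 : ℕ)) ⁻¹'
      Set.pi s t = t' 0 ×ˢ Set.pi (Finset.range m) fun i => t' (i + 1) := by
    ext ⟨k, η⟩
    simp only [Set.mem_preimage, Set.mem_pi, Finset.mem_coe, Set.mem_prod, Finset.mem_range]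
    constructor
    · intro h
      refine ⟨?_, fun i hi => ?_⟩
      · by_cases h0 : 0 ∈ s
        · simpa [ht', h0] using h 0 h0
        · simp [ht', h0]
      · by_cases h0 : i + 1 ∈ s
        · simpa [ht', h0] using h (i + 1) h0
        · simp [ht', h0]
    · rintro ⟨h0, h⟩ i hi
      cases i with
      | zero => simpa [ht', hi] using h0
      | succ i =>
        have := h i (by simpa using hm hi)
        simpa [ht', hi] using this
  rw [Measure.map_apply hmeas (MeasurableSet.pi s.countable_toSet fun i _ => ht i), hset,
    Measure.prod_prod, stepLaw, Measure.infinitePi_pi _ fun i _ => ht'm (i + 1), hprod,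
    Finset.prod_range_succ', mul_comm]

/-- Conditioning on the first step. -/
theorem integral_stepLaw {ρ : ℝ} (hρ0 : 0 < ρ) (hρ1 : ρ < 1) {F : ℕ → (ℕ → ℕ) → ℂ}
    (hF : Measurable fun q : ℕ × (ℕ → ℕ) => F q.1 q.2) {C : ℝ} (hC : ∀ k η, ‖F k η‖ ≤ C) :
    ∫ ξ, F (ξ 0) (fun i => ξ (i + 1)) ∂(stepLaw ρ) =
      ∑' k : ℕ, ((1 - ρ) ^ k * ρ) • ∫ η, F k η ∂(stepLaw ρ) := by
  set p := Set.projIcc (0 : ℝ) 1 zero_le_one ρ with hp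
  have hpρ : (p : ℝ) = ρ := by
    rw [hp, Set.projIcc_of_mem _ ⟨hρ0.le, hρ1.le⟩]
  have hp0 : p ≠ 0 := fun h0 => by
    rw [h0] at hpρ
    exact hρ0.ne hpρ
  have hmeas : Measurable fun (q : ℕ × (ℕ → ℕ)) (i : ℕ) => (Nat.casesOn i q.1 q.2 : ℕ) := by
    refine measurable_pi_lambda _ fun i => ?_
    cases i with
    | zero => exact measurable_fst
    | succ i => exact (measurable_pi_apply i).comp measurable_snd
  have hint : Integrable (fun q : ℕ × (ℕ → ℕ) => F q.1 q.2)
      ((geometricMeasure p).prod (stepLaw ρ)) :=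
    Integrable.of_bound hF.aestronglyMeasurable C (Filter.Eventually.of_forall fun q => hC _ _)
  have h2 : Measurable fun ξ : ℕ → ℕ => (ξ 0, fun i => ξ (i + 1)) := by fun_prop
  have h3 : AEStronglyMeasurable (fun ξ : ℕ → ℕ => F (ξ 0) fun i => ξ (i + 1))
      (Measure.map (fun (q : ℕ × (ℕ → ℕ)) (i : ℕ) => (Nat.casesOn i q.1 q.2 : ℕ))
        ((geometricMeasure p).prod (stepLaw ρ))) := (hF.comp h2).aestronglyMeasurable
  have h4 : ∫ ξ, F (ξ 0) (fun i => ξ (i + 1)) ∂(stepLaw ρ) =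
      ∫ q : ℕ × (ℕ → ℕ), F q.1 q.2 ∂((geometricMeasure p).prod (stepLaw ρ)) := by
    conv_lhs => rw [← map_prod_stepLaw ρ]
    exact integral_map hmeas.aemeasurable h3
  rw [h4, integral_prod _ hint, integral_geometricMeasure hp0, hpρ]

/-- The weight ρ(1-ρ)^k of the first step, the factor (1-ρ)/ρ per step and the inductive power
(1-ρ)^(x-1-k) multiply to (1-ρ)^x, whatever `k` is. The sum over the first step becomes the
unweighted sum in `hitGen`. -/
theorem integral_hitWeight {ρ : ℝ} (hρ0 : 0 < ρ) (hρ1 : ρ < 1) (B : ℤ) (v : ℂ) {n : ℕ}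
    {Y : Fin n → ℤ} (hB : ∀ i, B ≤ Y i) (x : ℤ) :
    ∫ ξ, hitWeight ρ Y v x ξ ∂(stepLaw ρ) = (1 - (ρ : ℂ)) ^ x * hitGen B v n Y x := by
  induction n generalizing x with
  | zero => simp [hitWeight_fin_zero, hitGen]
  | succ n ih =>
    have hρ1' : (1 : ℂ) - ρ ≠ 0 := by
      rw [sub_ne_zero]
      exact_mod_cast hρ1.ne'
    have hρ0' : (ρ : ℂ) ≠ 0 := by exact_mod_cast hρ0.ne'
    by_cases h : Y 0 < x
    · simp only [hitWeight_of_lt ρ v _ h, hitGen_of_lt B v h]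
      rw [integral_const, probReal_univ, one_smul, show -x - 1 = -(x + 1) by ring, zpow_neg,
        div_eq_mul_inv]
    rw [not_lt] at h
    simp only [hitWeight_of_le ρ v _ h]
    rw [integral_const_mul, hitGen_of_le B v h]
    have hB' : ∀ i, B ≤ Fin.tail Y i := fun i => hB i.succ
    have hW : Measurable fun q : ℕ × (ℕ → ℕ) =>
        hitWeight ρ (Fin.tail Y) v (x - ((q.1 : ℤ) + 1)) q.2 :=
      measurable_uncurry_step (fun y => measurable_hitWeight ρ v (Fin.tail Y) y) x
    obtain ⟨C, -, hC⟩ := exists_norm_hitWeight_le ρ v (Fin.tail Y) x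
    rw [integral_stepLaw hρ0 hρ1
      (F := fun k η => hitWeight ρ (Fin.tail Y) v (x - ((k : ℤ) + 1)) η) hW
      fun k η => hC _ (by omega) _]
    have hterm : ∀ k : ℕ, ((1 - ρ) ^ k * ρ) •
        ∫ η, hitWeight ρ (Fin.tail Y) v (x - ((k : ℤ) + 1)) η ∂(stepLaw ρ) =
        ρ * (1 - (ρ : ℂ)) ^ (x - 1) * hitGen B v n (Fin.tail Y) (x - 1 - k) := by
      intro k
      rw [ih hB', Complex.real_smul, show x - ((k : ℤ) + 1) = x - 1 - k by ring,
        zpow_sub₀ hρ1' (x - 1), zpow_natCast]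
      push_cast
      field_simp
    simp_rw [hterm]
    rw [tsum_mul_left]
    have hsum : ∑' k : ℕ, hitGen B v n (Fin.tail Y) (x - 1 - k) =
        ∑ x' ∈ Finset.Ico B x, hitGen B v n (Fin.tail Y) x' := by
      rw [tsum_eq_sum (s := Finset.range (x - B).toNat)]
      · refine Finset.sum_bij' (fun k _ => x - 1 - k) (fun x' _ => (x - 1 - x').toNat) ?_ ?_ ?_ ?_
          fun _ _ => rfl
        all_goals
          intro a ha
          simp only [Finset.mem_range, Finset.mem_Ico] at ha ⊢
          omega
      · intro k hk
        rw [Finset.mem_range] at hk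
        exact hitGen_eq_zero B v hB' (by omega)
    rw [hsum, zpow_sub_one₀ hρ1']
    field_simp

theorem chTerm_eq {ρ : ℝ} (hρ0 : 0 < ρ) (hρ1 : ρ < 1) (B : ℤ) (v u : ℂ)
    {n : ℕ} {Y : Fin n → ℤ} (hB : ∀ i, B ≤ Y i) (x : ℤ) :
    chTerm ρ Y v u x = (1 + u) ^ x * hitGen B v n Y x := by
  have hρ1' : (1 : ℂ) - ρ ≠ 0 := by
    rw [sub_ne_zero]
    exact_mod_cast hρ1.ne'
  have := zpow_ne_zero x hρ1'
  rw [chTerm, integral_hitWeight hρ0 hρ1 B v hB]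
  field_simp

/-! ### Bethe roots -/

section BetheRoots

variable {N L : ℕ} {z : ℂ}

theorem density_pos (hN : 0 < N) (hNL : N < L) : 0 < density N L := by
  have : 0 < L := hN.trans hNL
  unfold density
  positivity

theorem density_lt_one (hNL : N < L) : density N L < 1 := by
  have h : (0 : ℝ) < L := by exact_mod_cast (Nat.zero_le N).trans_lt hNL
  rw [density, div_lt_one h]
  exact_mod_cast hNL

theorem critRadius_pow (hN : 0 < N) (hNL : N < L) :
    critRadius N L ^ L = density N L ^ N * (1 - density N L) ^ (L - N) := by
  have h0 := density_pos hN hNL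
  have h1 := density_lt_one hNL
  have hL : (L : ℝ) ≠ 0 := by exact_mod_cast (hN.trans hNL).ne'
  have hρL : density N L * L = N := by
    rw [density]
    field_simp
  rw [critRadius, mul_pow, ← Real.rpow_mul_natCast h0.le, ← Real.rpow_mul_natCast (by linarith),
    hρL, show (1 - density N L) * (L : ℝ) = ((L - N : ℕ) : ℝ) by
      rw [Nat.cast_sub hNL.le, sub_mul, hρL, one_mul], Real.rpow_natCast, Real.rpow_natCast]

theorem norm_pow_lt (hN : 0 < N) (hNL : N < L) (hz : ‖z‖ < critRadius N L) :
    ‖z ^ L‖ < density N L ^ N * (1 - density N L) ^ (L - N) := by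
  rw [← critRadius_pow hN hNL, norm_pow]
  exact pow_lt_pow_left₀ hz (norm_nonneg _) (hN.trans hNL).ne'

theorem natDegree_bethe_monomial (hNL : N < L) :
    ((X : ℂ[X]) ^ N * (X + 1) ^ (L - N)).natDegree = L := by
  have h1 : ((X : ℂ[X]) + 1).Monic := monic_X_add_C 1
  have h2 : ((X : ℂ[X]) + 1).natDegree = 1 := natDegree_X_add_C 1
  rw [(monic_X_pow N).natDegree_mul (h1.pow _), h1.natDegree_pow, h2, natDegree_X_pow]
  omega

theorem monic_bethe_monomial : ((X : ℂ[X]) ^ N * (X + 1) ^ (L - N)).Monic :=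
  (monic_X_pow N).mul ((monic_X_add_C (1 : ℂ)).pow _)

theorem degree_C_lt_bethe_monomial (hNL : N < L) :
    (C (z ^ L)).degree < ((X : ℂ[X]) ^ N * (X + 1) ^ (L - N)).degree := by
  refine degree_C_le.trans_lt ?_
  rw [degree_eq_natDegree monic_bethe_monomial.ne_zero, natDegree_bethe_monomial hNL]
  exact_mod_cast (Nat.zero_le N).trans_lt hNL

theorem bethePoly_monic (hNL : N < L) : (bethePoly N L z).Monic :=
  monic_bethe_monomial.sub_of_left (degree_C_lt_bethe_monomial hNL)

theorem natDegree_bethePoly (hNL : N < L) : (bethePoly N L z).natDegree = L := by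
  rw [bethePoly, natDegree_sub_eq_left_of_natDegree_lt, natDegree_bethe_monomial hNL]
  rw [natDegree_C, natDegree_bethe_monomial hNL]
  omega

theorem eval_bethePoly (w : ℂ) :
    (bethePoly N L z).eval w = w ^ N * (w + 1) ^ (L - N) - z ^ L := by
  simp [bethePoly]

theorem mem_betheRoots (hNL : N < L) {w : ℂ} :
    w ∈ betheRoots N L z ↔ w ^ N * (w + 1) ^ (L - N) = z ^ L := by
  rw [betheRoots, Multiset.mem_toFinset, mem_roots (bethePoly_monic hNL).ne_zero, IsRoot.def,
    eval_bethePoly, sub_eq_zero]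

theorem ne_zero_of_mem_betheRoots (hN : 0 < N) (hNL : N < L) (hz0 : z ≠ 0) {w : ℂ}
    (hw : w ∈ betheRoots N L z) : w ≠ 0 ∧ w + 1 ≠ 0 := by
  rw [mem_betheRoots hNL] at hw
  have h : w ^ N * (w + 1) ^ (L - N) ≠ 0 := hw ▸ pow_ne_zero L hz0
  have hL : L - N ≠ 0 := by omega
  constructor
  · rintro rfl
    simp [hN.ne'] at h
  · intro h1
    simp [h1, hL] at h

theorem norm_bethe_lt (hN : 0 < N) (hNL : N < L) (hz : ‖z‖ < critRadius N L) {w : ℂ}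
    (hw : w ∈ betheRoots N L z) :
    ‖w‖ ^ N * ‖w + 1‖ ^ (L - N) < density N L ^ N * (1 - density N L) ^ (L - N) := by
  rw [mem_betheRoots hNL] at hw
  have := norm_pow_lt hN hNL hz
  rwa [← hw, norm_mul, norm_pow, norm_pow] at this

/-- Here |w| ≥ ρ, while |Q(w)| is below ρ^N (1-ρ)^(L-N); the other factor must be small. -/
theorem norm_add_one_lt (hN : 0 < N) (hNL : N < L) (hz : ‖z‖ < critRadius N L) {w : ℂ}
    (hw : w ∈ betheRoots N L z) (hre : w.re ≤ -density N L) : ‖w + 1‖ < 1 - density N L := by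
  have h0 := density_pos hN hNL
  have h1 := density_lt_one hNL
  have hn : density N L ≤ ‖w‖ := by
    have := Complex.abs_re_le_norm w
    rw [abs_of_neg (by linarith)] at this
    linarith
  have h := norm_bethe_lt hN hNL hz hw
  have h2 : density N L ^ N * ‖w + 1‖ ^ (L - N) ≤ ‖w‖ ^ N * ‖w + 1‖ ^ (L - N) := by
    gcongr
  have h3 := lt_of_mul_lt_mul_left (h2.trans_lt h) (pow_nonneg h0.le N)
  exact lt_of_pow_lt_pow_left₀ _ (by linarith) h3

/-- On the separating line |w+1| ≥ 1-ρ, against `norm_add_one_lt`. Hence every Bethe root is a left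
or a right one. -/
theorem re_ne_of_mem_betheRoots (hN : 0 < N) (hNL : N < L) (hz : ‖z‖ < critRadius N L) {w : ℂ}
    (hw : w ∈ betheRoots N L z) : w.re ≠ -density N L := by
  intro h
  have h1 := norm_add_one_lt hN hNL hz hw h.le
  have h2 := (le_abs_self _).trans (Complex.abs_re_le_norm (w + 1))
  rw [Complex.add_re, Complex.one_re, h] at h2
  linarith

theorem norm_lt_of_mem_rightRoots (hN : 0 < N) (hNL : N < L) (hz : ‖z‖ < critRadius N L) {w : ℂ}
    (hw : w ∈ rightRoots N L z) : ‖w‖ < density N L := by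
  obtain ⟨hw, hre⟩ := Finset.mem_filter.mp hw
  have h0 := density_pos hN hNL
  have h1 := density_lt_one hNL
  have hn : 1 - density N L ≤ ‖w + 1‖ := by
    have h2 := (le_abs_self _).trans (Complex.abs_re_le_norm (w + 1))
    rw [Complex.add_re, Complex.one_re] at h2
    linarith
  have h := norm_bethe_lt hN hNL hz hw
  have h2 : ‖w‖ ^ N * (1 - density N L) ^ (L - N) ≤ ‖w‖ ^ N * ‖w + 1‖ ^ (L - N) := by
    have : 0 ≤ 1 - density N L := by linarith
    gcongr
  have h3 := lt_of_mul_lt_mul_right (h2.trans_lt h) (pow_nonneg (by linarith) (L - N))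
  exact lt_of_pow_lt_pow_left₀ _ h0.le h3

theorem density_lt_norm_of_re_lt (hN : 0 < N) (hNL : N < L) {w : ℂ} (hre : w.re < -density N L) :
    density N L < ‖w‖ := by
  have := Complex.abs_re_le_norm w
  rw [abs_of_neg (by linarith [density_pos hN hNL])] at this
  linarith

theorem norm_lt_of_mem_leftRoots (hN : 0 < N) (hNL : N < L) (hz : ‖z‖ < critRadius N L) {w : ℂ}
    (hw : w ∈ leftRoots N L z) : ‖w + 1‖ < 1 - density N L ∧ density N L < ‖w‖ := by
  obtain ⟨hw, hre⟩ := Finset.mem_filter.mp hw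
  exact ⟨norm_add_one_lt hN hNL hz hw hre.le, density_lt_norm_of_re_lt hN hNL hre⟩

/-- The disc is convex, contains the left roots and excludes the right ones, so Cauchy's theorem for
a disc suffices for every admissible contour. -/
theorem leftRegion_subset (hN : 0 < N) (hNL : N < L) :
    leftRegion N L ⊆ Metric.ball (-1) (1 - density N L) := by
  rintro w ⟨h, hre⟩
  have h0 := density_pos hN hNL
  have h1 := density_lt_one hNL
  have hn := density_lt_norm_of_re_lt hN hNL hre
  rw [critRadius] at h
  have h2 : density N L ^ density N L * ‖w + 1‖ ^ (1 - density N L) ≤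
      ‖w‖ ^ density N L * ‖w + 1‖ ^ (1 - density N L) := by
    gcongr
  have h3 := lt_of_mul_lt_mul_left (h2.trans_lt h) (Real.rpow_nonneg h0.le _)
  rw [mem_ball_iff_norm, sub_neg_eq_add]
  exact (Real.rpow_lt_rpow_iff (norm_nonneg _) (by linarith) (by linarith)).mp h3

theorem betheRoots_eq_union (hN : 0 < N) (hNL : N < L) (hz : ‖z‖ < critRadius N L) :
    betheRoots N L z = rightRoots N L z ∪ leftRoots N L z := by
  ext w
  simp only [rightRoots, leftRoots, Finset.mem_union, Finset.mem_filter]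
  constructor
  · intro hw
    rcases lt_or_gt_of_ne (re_ne_of_mem_betheRoots hN hNL hz hw) with h | h
    · exact Or.inr ⟨hw, h⟩
    · exact Or.inl ⟨hw, h⟩
  · rintro (h | h) <;> exact h.1

theorem disjoint_rightRoots_leftRoots : Disjoint (rightRoots N L z) (leftRoots N L z) := by
  rw [rightRoots, leftRoots, Finset.disjoint_filter]
  intro w _ h1 h2
  exact lt_asymm h1 h2

theorem derivative_bethePoly_mul (hN : 0 < N) (hNL : N < L) (w : ℂ) :
    (derivative (bethePoly N L z)).eval w * (w * (w + 1)) =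
      w ^ N * (w + 1) ^ (L - N) * (L * w + N) := by
  obtain ⟨n, rfl⟩ := Nat.exists_eq_succ_of_ne_zero hN.ne'
  obtain ⟨m, hm⟩ := Nat.exists_eq_succ_of_ne_zero (Nat.sub_ne_zero_of_lt hNL)
  have hL : (L : ℂ) = (n + 1) + (m + 1) := by
    rw [← Nat.sub_add_cancel hNL.le, hm]
    push_cast
    ring
  rw [bethePoly, hm, hL]
  simp [derivative_mul, derivative_pow]
  ring

/-- Off 0 and -1 the only critical point is -ρ, which lies on the line free of roots. -/
theorem derivative_bethePoly_ne_zero (hN : 0 < N) (hNL : N < L) (hz0 : z ≠ 0)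
    (hz : ‖z‖ < critRadius N L) {w : ℂ} (hw : w ∈ betheRoots N L z) :
    (derivative (bethePoly N L z)).eval w ≠ 0 := by
  intro h
  have h1 := derivative_bethePoly_mul (z := z) hN hNL w
  have hL : (L : ℂ) ≠ 0 := by exact_mod_cast (hN.trans hNL).ne'
  rw [h, zero_mul, (mem_betheRoots hNL).mp hw, eq_comm, mul_eq_zero,
    or_iff_right (pow_ne_zero L hz0)]
    at h1
  have h2 : w = ((-density N L : ℝ) : ℂ) := by
    rw [density]
    push_cast
    field_simp
    linear_combination h1
  apply re_ne_of_mem_betheRoots hN hNL hz hw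
  rw [h2, Complex.ofReal_re]

theorem nodup_roots_bethePoly (hN : 0 < N) (hNL : N < L) (hz0 : z ≠ 0)
    (hz : ‖z‖ < critRadius N L) : (bethePoly N L z).roots.Nodup := by
  rw [Multiset.nodup_iff_count_le_one]
  intro w
  rw [count_roots]
  by_contra! h
  have hroot : w ∈ betheRoots N L z := by
    rw [betheRoots, Multiset.mem_toFinset, ← Multiset.count_pos, count_roots]
    omega
  apply derivative_bethePoly_ne_zero hN hNL hz0 hz hroot
  exact ((one_lt_rootMultiplicity_iff_isRoot (bethePoly_monic hNL).ne_zero).mp h).2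

theorem nodal_betheRoots (hN : 0 < N) (hNL : N < L) (hz0 : z ≠ 0) (hz : ‖z‖ < critRadius N L) :
    Lagrange.nodal (betheRoots N L z) id = bethePoly N L z := by
  have h := prod_multiset_X_sub_C_of_monic_of_roots_card_eq (bethePoly_monic (z := z) hNL)
    (splits_iff_card_roots.mp (IsAlgClosed.splits _))
  rw [Lagrange.nodal, betheRoots, Finset.prod, Multiset.toFinset_val,
    (nodup_roots_bethePoly hN hNL hz0 hz).dedup]
  exact h

theorem card_betheRoots (hN : 0 < N) (hNL : N < L) (hz0 : z ≠ 0) (hz : ‖z‖ < critRadius N L) :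
    (betheRoots N L z).card = L := by
  rw [← Lagrange.natDegree_nodal (R := ℂ) (v := id), nodal_betheRoots hN hNL hz0 hz,
    natDegree_bethePoly hNL]

theorem sum_inv_sub_betheRoots (hN : 0 < N) (hNL : N < L) (hz0 : z ≠ 0)
    (hz : ‖z‖ < critRadius N L) {v : ℂ} (hv : v ∉ betheRoots N L z) :
    ∑ w ∈ betheRoots N L z, (v - w)⁻¹ =
      (derivative (bethePoly N L z)).eval v / (bethePoly N L z).eval v := by
  rw [← nodal_betheRoots hN hNL hz0 hz, Lagrange.derivative_nodal, eval_finsetSum, Finset.sum_div]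
  refine Finset.sum_congr rfl fun w hw => ?_
  have hne : ∀ x ∈ betheRoots N L z, v - x ≠ 0 := fun x hx h => hv (sub_eq_zero.mp h ▸ hx)
  have h1 : ∏ x ∈ (betheRoots N L z).erase w, (v - x) ≠ 0 :=
    Finset.prod_ne_zero_iff.mpr fun x hx => hne x (Finset.mem_of_mem_erase hx)
  rw [Lagrange.eval_nodal, Lagrange.eval_nodal, ← Finset.mul_prod_erase _ _ hw]
  simp only [id]
  have h2 := hne w hw
  field_simp

theorem norm_bethe_le_of_mem_sphere (hN : 0 < N) (hNL : N < L) {v : ℂ}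
    (hv : v ∈ Metric.sphere (0 : ℂ) (density N L)) :
    density N L ^ N * (1 - density N L) ^ (L - N) ≤ ‖v ^ N * (v + 1) ^ (L - N)‖ := by
  have h0 := density_pos hN hNL
  have h1 := density_lt_one hNL
  rw [mem_sphere_zero_iff_norm] at hv
  have h2 : 1 - density N L ≤ ‖v + 1‖ := by
    have := norm_sub_norm_le 1 (-v)
    rw [norm_neg, norm_one, hv, sub_neg_eq_add, add_comm 1 v] at this
    exact this
  have h3 : 0 ≤ 1 - density N L := by linarith
  rw [norm_mul, norm_pow, norm_pow, hv]
  gcongr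

/-- There are exactly `N` right Bethe roots, by the argument principle on `|v| = ρ`. -/
theorem card_rightRoots (hN : 0 < N) (hNL : N < L) (hz0 : z ≠ 0) (hz : ‖z‖ < critRadius N L) :
    (rightRoots N L z).card = N := by
  have h0 := density_pos hN hNL
  have h1 := density_lt_one hNL
  have hπ : (2 * Real.pi * Complex.I : ℂ) ≠ 0 := by simp [Real.pi_ne_zero]
  set ρ := density N L with hρ
  have hv0 : ∀ v ∈ Metric.sphere (0 : ℂ) ρ, v ≠ 0 := fun v => ne_zero_of_mem_sphere h0
  have hv1 : ∀ v ∈ Metric.closedBall (0 : ℂ) ρ, v + 1 ≠ 0 := fun v hv => by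
    rw [add_comm]
    exact one_add_ne_zero_of_mem_ball (Metric.closedBall_subset_ball h1 hv)
  have hbig : ∀ v ∈ Metric.sphere (0 : ℂ) ρ, ‖z ^ L‖ < ‖v ^ N * (v + 1) ^ (L - N)‖ :=
    fun v hv => (norm_pow_lt hN hNL hz).trans_le (norm_bethe_le_of_mem_sphere hN hNL hv)
  have hnot : ∀ v ∈ Metric.sphere (0 : ℂ) ρ, v ∉ betheRoots N L z := fun v hv hmem => by
    have := hbig v hv
    rw [(mem_betheRoots hNL).mp hmem] at this
    exact lt_irrefl _ this
  have hcont : ∀ w ∈ betheRoots N L z,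
      ContinuousOn (fun v : ℂ => (v - w)⁻¹) (Metric.sphere 0 ρ) := fun w hw =>
    (continuousOn_id.sub continuousOn_const).inv₀ fun v hv h => by
      obtain rfl : v = w := sub_eq_zero.mp h
      exact hnot v hv hw
  have hleft : ∮ v in C(0, ρ), ∑ w ∈ betheRoots N L z, (v - w)⁻¹ =
      (rightRoots N L z).card * (2 * Real.pi * Complex.I) := by
    rw [circleIntegral.integral_fun_sum fun w hw => (hcont w hw).circleIntegrable h0.le,
      betheRoots_eq_union hN hNL hz, Finset.sum_union disjoint_rightRoots_leftRoots,
      Finset.sum_congr rfl fun w hw => circleIntegral.integral_sub_inv_of_mem_ball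
        (mem_ball_zero_iff.mpr (norm_lt_of_mem_rightRoots hN hNL hz hw)),
      Finset.sum_const, nsmul_eq_mul, add_eq_left]
    -- Left roots lie outside the closed disc of radius ρ and contribute nothing.
    refine Finset.sum_eq_zero fun w hw => ?_
    have hw' := (norm_lt_of_mem_leftRoots hN hNL hz hw).2
    refine DiffContOnCl.circleIntegral_eq_zero h0.le (DifferentiableOn.diffContOnCl ?_)
    refine (differentiableOn_id.sub (differentiableOn_const w)).inv fun v hv h => ?_
    have hv' := Metric.closure_ball_subset_closedBall hv
    rw [mem_closedBall_zero_iff] at hv'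
    obtain rfl : v = w := sub_eq_zero.mp h
    linarith
  -- On the circle |z^L / Q| < 1, so P/Q stays within distance 1 of 1 and has a holomorphic
  -- logarithm. Its derivative P'/P - Q'/Q integrates to zero, and P has as many zeros inside as Q,
  -- namely N.
  have hlog : ∮ v in C(0, ρ), (∑ w ∈ betheRoots N L z, (v - w)⁻¹ -
      (N * (v - 0)⁻¹ + (L - N : ℕ) * (v + 1)⁻¹)) = 0 := by
    refine circleIntegral.integral_eq_zero_of_hasDerivWithinAt (f := fun v =>
      Complex.log (1 + -(z ^ L * (v ^ N * (v + 1) ^ (L - N))⁻¹))) h0.le fun v hv => ?_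
    have hQ : v ^ N * (v + 1) ^ (L - N) ≠ 0 :=
      mul_ne_zero (pow_ne_zero _ (hv0 v hv))
        (pow_ne_zero _ (hv1 v (Metric.sphere_subset_closedBall hv)))
    have hder : HasDerivAt (fun v : ℂ => v ^ N * (v + 1) ^ (L - N))
        ((derivative (bethePoly N L z)).eval v) v := by
      have := ((bethePoly N L z).hasDerivAt v).add_const (z ^ L)
      refine this.congr_of_eventuallyEq (Filter.Eventually.of_forall fun w => ?_)
      simp [eval_bethePoly]
    have hslit : 1 + -(z ^ L * (v ^ N * (v + 1) ^ (L - N))⁻¹) ∈ Complex.slitPlane := by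
      apply Complex.mem_slitPlane_of_norm_lt_one
      rw [norm_neg, norm_mul, norm_inv, ← div_eq_mul_inv, div_lt_one (norm_pos_iff.mpr hQ)]
      exact hbig v hv
    have h := ((((hder.inv hQ).const_mul (z ^ L)).neg.const_add 1).clog hslit).hasDerivWithinAt
      (s := Metric.sphere 0 ρ)
    refine h.congr_deriv ?_
    have hP : v ^ N * (v + 1) ^ (L - N) - z ^ L ≠ 0 := fun h =>
      hnot v hv ((mem_betheRoots hNL).mpr (sub_eq_zero.mp h))
    have hv0' := hv0 v hv
    have hv1' := hv1 v (Metric.sphere_subset_closedBall hv)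
    have hd := derivative_bethePoly_mul (z := z) hN hNL v
    have hd2 : (N * (v - 0)⁻¹ + (L - N : ℕ) * (v + 1)⁻¹ : ℂ) =
        (derivative (bethePoly N L z)).eval v / (v ^ N * (v + 1) ^ (L - N)) := by
      rw [eq_div_iff hQ, sub_zero, Nat.cast_sub hNL.le]
      apply mul_right_cancel₀ (mul_ne_zero hv0' hv1')
      rw [hd]
      field_simp
      ring
    rw [sum_inv_sub_betheRoots hN hNL hz0 hz (hnot v hv), hd2, eval_bethePoly]
    set Q := v ^ N * (v + 1) ^ (L - N)
    have hQ1 : 1 + -(z ^ L * Q⁻¹) = (Q - z ^ L) / Q := by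
      field_simp
      ring
    change -(z ^ L * (-_ / Q ^ 2)) / (1 + -(z ^ L * Q⁻¹)) = _
    rw [hQ1]
    field_simp
    ring
  have hcont0 : ContinuousOn (fun v : ℂ => (N : ℂ) * (v - 0)⁻¹) (Metric.sphere 0 ρ) :=
    continuousOn_const.mul ((continuousOn_id.sub continuousOn_const).inv₀ fun v hv => by
      simpa using hv0 v hv)
  have hdiff1 : DifferentiableOn ℂ (fun v : ℂ => ((L - N : ℕ) : ℂ) * (v + 1)⁻¹)
      (Metric.closedBall 0 ρ) :=
    (differentiableOn_const _).mul ((differentiableOn_id.add (differentiableOn_const 1)).inv hv1)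
  have hright : ∮ v in C(0, ρ), ((N : ℂ) * (v - 0)⁻¹ + (L - N : ℕ) * (v + 1)⁻¹) =
      N * (2 * Real.pi * Complex.I) := by
    rw [circleIntegral.integral_add (hcont0.circleIntegrable h0.le)
      ((hdiff1.continuousOn.mono Metric.sphere_subset_closedBall).circleIntegrable h0.le),
      circleIntegral.integral_const_mul, circleIntegral.integral_sub_center_inv _ h0.ne',
      DiffContOnCl.circleIntegral_eq_zero h0.le
        (hdiff1.mono Metric.closure_ball_subset_closedBall).diffContOnCl, add_zero]
  rw [circleIntegral.integral_sub
    ((continuousOn_finsetSum _ hcont).circleIntegrable h0.le)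
    ((hcont0.fun_add (hdiff1.continuousOn.mono Metric.sphere_subset_closedBall)).circleIntegrable
      h0.le),
    hleft, hright, sub_eq_zero] at hlog
  exact_mod_cast mul_right_cancel₀ hπ hlog

/-- Lagrange interpolation at the Bethe roots. -/
theorem eval_eq_sum_basis (hN : 0 < N) (hNL : N < L) (hz0 : z ≠ 0) (hz : ‖z‖ < critRadius N L)
    {p : ℂ[X]} (hp : p.degree < L) (v : ℂ) :
    p.eval v = ∑ w ∈ betheRoots N L z,
      p.eval w * (Lagrange.basis (betheRoots N L z) id w).eval v := by
  have h := Lagrange.eq_interpolate (s := betheRoots N L z) (v := id)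
    (Function.injective_id.injOn) (f := p) (by rwa [card_betheRoots hN hNL hz0 hz])
  conv_lhs => rw [h, Lagrange.interpolate_apply, eval_finsetSum]
  simp

theorem eval_basis_eq (hN : 0 < N) (hNL : N < L) (hz0 : z ≠ 0) (hz : ‖z‖ < critRadius N L)
    {w v : ℂ} (hw : w ∈ betheRoots N L z) (hvw : v ≠ w) :
    (Lagrange.basis (betheRoots N L z) id w).eval v =
      (v ^ N * (v + 1) ^ (L - N) - z ^ L) /
        ((derivative (bethePoly N L z)).eval w * (v - w)) := by
  rw [Lagrange.eval_basis_not_at_node hw (by exact hvw),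
    Lagrange.nodalWeight_eq_eval_derivative_nodal hw, nodal_betheRoots hN hNL hz0 hz,
    eval_bethePoly]
  simp only [id]
  rw [div_eq_mul_inv, mul_inv]

/-- Partial fractions. -/
theorem inv_bethePoly_eq (hN : 0 < N) (hNL : N < L) (hz0 : z ≠ 0) (hz : ‖z‖ < critRadius N L)
    {v : ℂ} (hv : v ∉ betheRoots N L z) :
    (v ^ N * (v + 1) ^ (L - N) - z ^ L)⁻¹ =
      ∑ w ∈ betheRoots N L z, ((derivative (bethePoly N L z)).eval w)⁻¹ * (v - w)⁻¹ := by
  have h := eval_eq_sum_basis hN hNL hz0 hz (p := 1)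
    (by rw [degree_one]; exact_mod_cast hN.trans hNL) v
  have hP : v ^ N * (v + 1) ^ (L - N) - z ^ L ≠ 0 := fun h =>
    hv ((mem_betheRoots hNL).mpr (sub_eq_zero.mp h))
  have h2 : (1 : ℂ) = ∑ w ∈ betheRoots N L z, (v ^ N * (v + 1) ^ (L - N) - z ^ L) *
      (((derivative (bethePoly N L z)).eval w)⁻¹ * (v - w)⁻¹) := by
    refine (eval_one.symm.trans h).trans (Finset.sum_congr rfl fun w hw => ?_)
    rw [eval_basis_eq hN hNL hz0 hz hw fun h => hv (by rwa [h]), eval_one, one_mul, ← mul_inv,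
      div_eq_mul_inv]
  rw [← Finset.mul_sum] at h2
  exact inv_eq_of_mul_eq_one_right h2.symm

end BetheRoots

/-! ### Contour integrals along piecewise `C¹` paths -/

section Contour

variable {c : ℂ} {γ : Path c c}

theorem curveIntegralFun_form (γ : Path c c) (f : ℂ → ℂ) (t : ℝ) :
    curveIntegralFun (form f) γ t =
      f (γ.extend t) * derivWithin γ.extend (Set.Icc 0 1) t := by
  rw [curveIntegralFun_def]
  simp [form]

/-- A contour may pass through -1, where the integrand takes conventional values; exceptional times
are allowed for this reason. -/
theorem contourIntegral_congr_of_countable {f g : ℂ → ℂ} {S : Set ℝ} (hS : S.Countable)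
    (h : ∀ t : unitInterval, (t : ℝ) ∉ S → f (γ t) = g (γ t)) :
    contourIntegral γ f = contourIntegral γ g ∧
      (CurveIntegrable (form f) γ ↔ CurveIntegrable (form g) γ) := by
  have hae : ∀ᵐ t : ℝ, t ∈ Set.uIoc (0 : ℝ) 1 →
      curveIntegralFun (form f) γ t = curveIntegralFun (form g) γ t := by
    filter_upwards [hS.ae_notMem volume] with t ht hmem
    rw [Set.uIoc_of_le zero_le_one] at hmem
    have hI : t ∈ unitInterval := ⟨hmem.1.le, hmem.2⟩
    rw [curveIntegralFun_form, curveIntegralFun_form, Path.extend_apply _ hI, h ⟨t, hI⟩ ht]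
  constructor
  · rw [contourIntegral, contourIntegral, curveIntegral_def, curveIntegral_def,
      intervalIntegral.integral_congr_ae hae]
  · exact intervalIntegrable_congr_ae ((ae_restrict_iff' measurableSet_uIoc).mpr hae)

theorem contourIntegral_congr {f g : ℂ → ℂ} (h : ∀ t, f (γ t) = g (γ t)) :
    contourIntegral γ f = contourIntegral γ g :=
  (contourIntegral_congr_of_countable Set.countable_empty fun t _ => h t).1

theorem form_add (f g : ℂ → ℂ) : (form fun w => f w + g w) = form f + form g := by
  funext w
  ext
  simp [form]

theorem form_const_mul (a : ℂ) (f : ℂ → ℂ) : (form fun w => a * f w) = a • form f := by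
  funext w
  simp [form, mul_smul]

theorem contourIntegral_add {f g : ℂ → ℂ} (hf : CurveIntegrable (form f) γ)
    (hg : CurveIntegrable (form g) γ) :
    contourIntegral γ (fun w => f w + g w) = contourIntegral γ f + contourIntegral γ g := by
  rw [contourIntegral, form_add, curveIntegral_add hf hg, mul_add]
  rfl

theorem contourIntegral_const_mul (a : ℂ) (f : ℂ → ℂ) :
    contourIntegral γ (fun w => a * f w) = a * contourIntegral γ f := by
  rw [contourIntegral, contourIntegral, form_const_mul, curveIntegral_smul, smul_eq_mul]
  ring

theorem contourIntegral_sum {ι : Type*} (s : Finset ι) {f : ι → ℂ → ℂ}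
    (hf : ∀ i ∈ s, CurveIntegrable (form (f i)) γ) :
    contourIntegral γ (fun w => ∑ i ∈ s, f i w) = ∑ i ∈ s, contourIntegral γ (f i) := by
  have hadd : ∀ t, curveIntegralFun (form fun w => ∑ i ∈ s, f i w) γ t =
      ∑ i ∈ s, curveIntegralFun (form (f i)) γ t := by
    intro t
    simp only [curveIntegralFun_form, Finset.sum_mul]
  simp only [contourIntegral, curveIntegral_def, hadd]
  rw [intervalIntegral.integral_finsetSum hf, Finset.mul_sum]

theorem derivWithin_eq_of_mem_Ioo {a b t : ℝ} (ha : 0 ≤ a) (hb : b ≤ 1) (ht : t ∈ Set.Ioo a b) :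
    derivWithin γ.extend (Set.Icc 0 1) t = derivWithin γ.extend (Set.Icc a b) t := by
  rw [derivWithin_of_mem_nhds (Icc_mem_nhds ht.1 ht.2),
    derivWithin_of_mem_nhds (Icc_mem_nhds (ha.trans_lt ht.1) (ht.2.trans_le hb))]

theorem curveIntegrable_of_continuousOn (hγ : PiecewiseC1 γ) {f : ℂ → ℂ} {s : Set ℂ}
    (hf : ContinuousOn f s) (hs : ∀ t, γ t ∈ s) : CurveIntegrable (form f) γ := by
  obtain ⟨n, t, hmono, h0, h1, hC⟩ := hγ
  rw [CurveIntegrable, ← h0, ← h1]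
  refine IntervalIntegrable.trans_iterate fun i hi => ?_
  have h0' : 0 ≤ t i := h0 ▸ hmono (Nat.zero_le i)
  have h1' : t (i + 1) ≤ 1 := h1 ▸ hmono hi
  rcases (hmono (Nat.le_succ i)).eq_or_lt with heq | hlt
  · rw [Nat.succ_eq_add_one] at heq
    rw [heq]
  · have hcont : ContinuousOn (fun τ => f (γ.extend τ) *
        derivWithin γ.extend (Set.Icc (t i) (t (i + 1))) τ) (Set.Icc (t i) (t (i + 1))) := by
      refine ContinuousOn.mul ?_ ((hC i hi).continuousOn_derivWithin
        (uniqueDiffOn_Icc hlt) le_rfl)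
      refine hf.comp γ.continuous_extend.continuousOn fun τ hτ => ?_
      rw [Path.extend_apply _ ⟨h0'.trans hτ.1, hτ.2.trans h1'⟩]
      exact hs _
    -- The one-sided derivatives at the nodes may differ from the derivative on [0, 1], hence the
    -- comparison on the open interval.
    refine (intervalIntegrable_congr_uIoo fun τ hτ => ?_).mpr
      (hcont.intervalIntegrable_of_Icc hlt.le)
    rw [Set.uIoo_of_le hlt.le] at hτ
    rw [curveIntegralFun_form, derivWithin_eq_of_mem_Ioo h0' h1' hτ]

/-- The fundamental theorem of calculus holds off the countably many nodes, and the endpoints of a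
closed path agree. -/
theorem contourIntegral_eq_zero_of_hasDerivAt (hγ : PiecewiseC1 γ) {f F : ℂ → ℂ} {s : Set ℂ}
    (hf : ContinuousOn f s) (hF : ∀ w ∈ s, HasDerivAt F (f w) w) (hs : ∀ t, γ t ∈ s) :
    contourIntegral γ f = 0 := by
  have hint := curveIntegrable_of_continuousOn hγ hf hs
  obtain ⟨n, t, hmono, h0, h1, hC⟩ := hγ
  have hext : ∀ τ, γ.extend τ ∈ s := fun τ => hs (Set.projIcc 0 1 zero_le_one τ)
  rw [contourIntegral, curveIntegral_def, integral_eq_of_hasDerivAt_off_countable_of_le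
    (fun τ => F (γ.extend τ)) _ zero_le_one (Set.countable_range t) ?_ ?_ hint]
  · simp
  · intro τ _
    exact ((hF _ (hext τ)).continuousAt.comp γ.continuous_extend.continuousAt).continuousWithinAt
  · rintro τ ⟨hτ, hτt⟩
    -- The first node beyond τ locates the open piece that contains τ.
    have hex : ∃ m, τ < t m := ⟨n, h1 ▸ hτ.2⟩
    classical
    have hm0 : Nat.find hex ≠ 0 := fun h => by
      have := Nat.find_spec hex
      rw [h, h0] at this
      exact lt_asymm this hτ.1
    obtain ⟨i, hi⟩ := Nat.exists_eq_succ_of_ne_zero hm0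
    have hlt : τ < t (i + 1) := by
      have := Nat.find_spec hex
      rwa [hi] at this
    have hle : t i ≤ τ := not_lt.mp (Nat.find_min hex (by omega))
    have hlt' : t i < τ := lt_of_le_of_ne hle fun h => hτt ⟨i, h⟩
    have hin : i < n := by
      by_contra! hni
      have := hmono hni
      rw [h1] at this
      linarith [hτ.2]
    have hd : DifferentiableAt ℝ γ.extend τ :=
      ((hC i hin).differentiableOn one_ne_zero τ ⟨hle, hlt.le⟩).differentiableAt
        (Icc_mem_nhds hlt' hlt)
    have h := (hF _ (hext τ)).comp_of_eq τ hd.hasDerivAt rfl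
    rw [curveIntegralFun_form, derivWithin_of_mem_nhds (Icc_mem_nhds hτ.1 hτ.2)]
    exact h

theorem contourIntegral_eq_zero (hγ : PiecewiseC1 γ) {f : ℂ → ℂ} {a : ℂ} {R : ℝ}
    (hf : DifferentiableOn ℂ f (Metric.ball a R)) (hs : ∀ t, γ t ∈ Metric.ball a R) :
    contourIntegral γ f = 0 := by
  obtain ⟨F, hF⟩ := hf.isExactOn_ball
  exact contourIntegral_eq_zero_of_hasDerivAt hγ hf.continuousOn hF hs

/-- Subtracting f(u)/(w-u) leaves the difference quotient, which is holomorphic on the disc and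
integrates to zero. -/
theorem contourIntegral_mul_inv_sub (hγ : PiecewiseC1 γ) {f : ℂ → ℂ} {a : ℂ} {R : ℝ}
    (hf : DifferentiableOn ℂ f (Metric.ball a R)) (hs : ∀ t, γ t ∈ Metric.ball a R)
    {u : ℂ} (hu : u ∈ Metric.ball a R) (hne : ∀ t, γ t ≠ u)
    (hw : contourIntegral γ (fun w => (w - u)⁻¹) = 1) :
    contourIntegral γ (fun w => f w * (w - u)⁻¹) = f u := by
  have hd : DifferentiableOn ℂ (dslope f u) (Metric.ball a R) :=
    (Complex.differentiableOn_dslope (Metric.isOpen_ball.mem_nhds hu)).mpr hf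
  have h1 : CurveIntegrable (form (dslope f u)) γ :=
    curveIntegrable_of_continuousOn hγ hd.continuousOn hs
  have h2 : CurveIntegrable (form fun w => f u * (w - u)⁻¹) γ := by
    refine curveIntegrable_of_continuousOn hγ (s := {u}ᶜ) ?_ fun t => hne t
    exact continuousOn_const.mul ((continuousOn_id.sub continuousOn_const).inv₀ fun w hw h =>
      hw (sub_eq_zero.mp h))
  have h3 : contourIntegral γ (fun w => f w * (w - u)⁻¹) =
      contourIntegral γ (fun w => dslope f u w + f u * (w - u)⁻¹) := by
    refine contourIntegral_congr fun t => ?_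
    rw [dslope_of_ne _ (hne t), slope_def_field]
    field_simp [sub_ne_zero.mpr (hne t)]
    ring
  rw [h3, contourIntegral_add h1 h2, contourIntegral_eq_zero hγ hd hs, contourIntegral_const_mul,
    hw, zero_add, mul_one]

end Contour

/-! ### Residues at the left Bethe roots -/

section Residues

variable {N L : ℕ} {z : ℂ} {c : ℂ} {γ : Path c c}

theorem IsLeftContour.mem_ball (hγ : IsLeftContour N L z γ) (hN : 0 < N) (hNL : N < L)
    (t : unitInterval) : γ t ∈ Metric.ball (-1 : ℂ) (1 - density N L) :=
  leftRegion_subset hN hNL (hγ.mem_region t)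

theorem IsLeftContour.notMem_betheRoots (hγ : IsLeftContour N L z γ) (t : unitInterval) :
    γ t ∉ betheRoots N L z := fun h =>
  hγ.avoids _ (Finset.mem_filter.mpr ⟨h, (hγ.mem_region t).2⟩) t rfl

theorem not_mem_ball_of_mem_rightRoots {w : ℂ} (hw : w ∈ rightRoots N L z) :
    w ∉ Metric.ball (-1 : ℂ) (1 - density N L) := by
  intro h
  rw [mem_ball_iff_norm, sub_neg_eq_add] at h
  have h1 := (le_abs_self _).trans (Complex.abs_re_le_norm (w + 1))
  rw [Complex.add_re, Complex.one_re] at h1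
  linarith [(Finset.mem_filter.mp hw).2]

theorem IsLeftContour.curveIntegrable_div (hγ : IsLeftContour N L z γ) (hN : 0 < N)
    (hNL : N < L) {f : ℂ → ℂ}
    (hf : ContinuousOn f (Metric.ball (-1 : ℂ) (1 - density N L))) :
    CurveIntegrable (form fun u => f u * (u ^ N * (u + 1) ^ (L - N) - z ^ L)⁻¹) γ := by
  refine curveIntegrable_of_continuousOn hγ.piecewiseC1
    (s := Metric.ball (-1 : ℂ) (1 - density N L) ∩ (betheRoots N L z : Set ℂ)ᶜ) ?_
    fun t => ⟨hγ.mem_ball hN hNL t, hγ.notMem_betheRoots t⟩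
  refine (hf.mono Set.inter_subset_left).mul (ContinuousOn.inv₀ (by fun_prop) fun w hw h => ?_)
  exact hw.2 ((mem_betheRoots hNL).mpr (sub_eq_zero.mp h))

/-- The residue theorem for a left contour. -/
theorem IsLeftContour.contourIntegral_div (hγ : IsLeftContour N L z γ) (hN : 0 < N)
    (hNL : N < L) (hz0 : z ≠ 0) (hz : ‖z‖ < critRadius N L) {f : ℂ → ℂ}
    (hf : DifferentiableOn ℂ f (Metric.ball (-1 : ℂ) (1 - density N L))) :
    contourIntegral γ (fun u => f u * (u ^ N * (u + 1) ^ (L - N) - z ^ L)⁻¹) =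
      ∑ u ∈ leftRoots N L z, f u * ((derivative (bethePoly N L z)).eval u)⁻¹ := by
  have hball := hγ.mem_ball hN hNL
  have h1 : contourIntegral γ (fun u => f u * (u ^ N * (u + 1) ^ (L - N) - z ^ L)⁻¹) =
      contourIntegral γ (fun u => ∑ w ∈ betheRoots N L z,
        ((derivative (bethePoly N L z)).eval w)⁻¹ * (f u * (u - w)⁻¹)) := by
    refine contourIntegral_congr fun t => ?_
    rw [inv_bethePoly_eq hN hNL hz0 hz (hγ.notMem_betheRoots t), Finset.mul_sum]
    exact Finset.sum_congr rfl fun w _ => by ring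
  have hint : ∀ w ∈ betheRoots N L z, CurveIntegrable (form fun u =>
      ((derivative (bethePoly N L z)).eval w)⁻¹ * (f u * (u - w)⁻¹)) γ := by
    intro w hw
    refine curveIntegrable_of_continuousOn hγ.piecewiseC1
      (s := Metric.ball (-1 : ℂ) (1 - density N L) ∩ (betheRoots N L z : Set ℂ)ᶜ) ?_
      fun t => ⟨hγ.mem_ball hN hNL t, hγ.notMem_betheRoots t⟩
    refine continuousOn_const.mul ((hf.continuousOn.mono Set.inter_subset_left).mul
      ((continuousOn_id.sub continuousOn_const).inv₀ fun v hv h => ?_))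
    obtain rfl : v = w := sub_eq_zero.mp h
    exact hv.2 hw
  rw [h1, contourIntegral_sum _ hint, betheRoots_eq_union hN hNL hz,
    Finset.sum_union disjoint_rightRoots_leftRoots, Finset.sum_eq_zero, zero_add]
  · refine Finset.sum_congr rfl fun w hw => ?_
    have hwball : w ∈ Metric.ball (-1 : ℂ) (1 - density N L) := by
      rw [mem_ball_iff_norm, sub_neg_eq_add]
      exact (norm_lt_of_mem_leftRoots hN hNL hz hw).1
    rw [contourIntegral_const_mul, contourIntegral_mul_inv_sub hγ.piecewiseC1 hf hball hwball
      (hγ.avoids w hw) (hγ.winding w hw), mul_comm]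
  -- For a right root the pole lies outside the disc, so no information on its winding number is
  -- needed.
  · intro w hw
    rw [contourIntegral_const_mul, contourIntegral_eq_zero hγ.piecewiseC1 _ hball, mul_zero]
    refine hf.mul ((differentiableOn_id.sub (differentiableOn_const w)).inv fun v hv h => ?_)
    obtain rfl : v = w := sub_eq_zero.mp h
    exact not_mem_ball_of_mem_rightRoots hw hv

/-- A simple contour passes through a given point at most twice. -/
theorem IsLeftContour.countable_preimage (hγ : IsLeftContour N L z γ) (a : ℂ) :
    {t : ℝ | ∃ h : t ∈ unitInterval, γ ⟨t, h⟩ = a}.Countable := by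
  have h1 : {t : ℝ | ∃ h : t ∈ unitInterval, γ ⟨t, h⟩ = a} ⊆
      {t : ℝ | t < 1 ∧ ∃ h : t ∈ unitInterval, γ ⟨t, h⟩ = a} ∪ {1} := by
    rintro t ⟨ht, hγt⟩
    rcases ht.2.eq_or_lt with h | h
    · exact Or.inr h
    · exact Or.inl ⟨h, ht, hγt⟩
  refine Set.Countable.mono h1 (Set.Countable.union ?_ (Set.countable_singleton 1))
  refine Set.Subsingleton.countable ?_
  rintro s ⟨hs1, hs, hγs⟩ t ⟨ht1, ht, hγt⟩
  have hs' : (⟨s, hs⟩ : unitInterval) ∈ {t : unitInterval | t < 1} := hs1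
  have ht' : (⟨t, ht⟩ : unitInterval) ∈ {t : unitInterval | t < 1} := ht1
  have := hγ.simple hs' ht' (hγs.trans hγt.symm)
  exact congrArg Subtype.val this

end Residues

/-! ### The kernel as a kernel of finite rank -/

theorem circleMean_eq_zero_of_closedBall {r : ℝ} (hr0 : 0 < r) {f : ℂ → ℂ}
    (hf : DifferentiableOn ℂ f (Metric.closedBall 0 r)) : circleMean r f = 0 := by
  rw [circleMean, DiffContOnCl.circleIntegral_eq_zero hr0.le
    (hf.mono Metric.closure_ball_subset_closedBall).diffContOnCl, mul_zero]

theorem norm_circleMean_le {r : ℝ} (hr0 : 0 < r) {f : ℂ → ℂ} {C : ℝ}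
    (h : ∀ v ∈ Metric.sphere (0 : ℂ) r, ‖f v‖ ≤ C) : ‖circleMean r f‖ ≤ r * C := by
  rw [circleMean, ← smul_eq_mul]
  exact circleIntegral.norm_two_pi_i_inv_smul_integral_le_of_norm_le_const hr0.le h

theorem one_sub_le_norm_add_one {r : ℝ} {v : ℂ} (hv : v ∈ Metric.sphere (0 : ℂ) r) :
    1 - r ≤ ‖v + 1‖ := by
  rw [mem_sphere_zero_iff_norm] at hv
  have := norm_sub_norm_le 1 (-v)
  rwa [norm_neg, norm_one, hv, sub_neg_eq_add, add_comm 1 v] at this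

/-- Termwise integration of a geometric series over a circle. -/
theorem hasSum_circleMean_geometric {r : ℝ} (hr0 : 0 < r) (hr1 : r < 1) {g : ℂ → ℂ}
    (hg : ContinuousOn g (Metric.sphere 0 r)) {u : ℂ} (hu : ‖u + 1‖ < 1 - r) :
    (Summable fun m : ℕ => ‖(u + 1) ^ m * circleMean r (fun v => g v * ((v + 1) ^ (m + 1))⁻¹)‖) ∧
    HasSum (fun m : ℕ => (u + 1) ^ m * circleMean r (fun v => g v * ((v + 1) ^ (m + 1))⁻¹))
      (circleMean r (fun v => g v * (v - u)⁻¹)) := by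
  obtain ⟨C, hC⟩ := (isCompact_sphere (0 : ℂ) r).exists_bound_of_continuousOn hg
  have hr1' : 0 < 1 - r := by linarith
  have hC0 : 0 ≤ C := by
    refine (norm_nonneg _).trans (hC (r : ℂ) ?_)
    rw [mem_sphere_zero_iff_norm, Complex.norm_real, Real.norm_of_nonneg hr0.le]
  set q := ‖u + 1‖ / (1 - r) with hq
  have hq0 : 0 ≤ q := by positivity
  have hq1 : q < 1 := by rwa [hq, div_lt_one hr1']
  have hv1 : ∀ v ∈ Metric.sphere (0 : ℂ) r, v + 1 ≠ 0 := fun v hv h => by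
    have := one_sub_le_norm_add_one hv
    rw [h, norm_zero] at this
    linarith
  have hvu : ∀ v ∈ Metric.sphere (0 : ℂ) r, v - u ≠ 0 := fun v hv h => by
    have := one_sub_le_norm_add_one hv
    rw [sub_eq_zero.mp h] at this
    linarith
  have hterm : ∀ m : ℕ, ‖(u + 1) ^ m * circleMean r (fun v => g v * ((v + 1) ^ (m + 1))⁻¹)‖ ≤
      r * (C * (1 - r)⁻¹) * q ^ m := by
    intro m
    have h1 : ‖circleMean r (fun v => g v * ((v + 1) ^ (m + 1))⁻¹)‖ ≤
        r * (C * ((1 - r) ^ (m + 1))⁻¹) := by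
      refine norm_circleMean_le hr0 fun v hv => ?_
      rw [norm_mul, norm_inv, norm_pow]
      have h2 := one_sub_le_norm_add_one hv
      gcongr
      exact hC v hv
    rw [norm_mul, norm_pow]
    calc ‖u + 1‖ ^ m * ‖circleMean r (fun v => g v * ((v + 1) ^ (m + 1))⁻¹)‖
        ≤ ‖u + 1‖ ^ m * (r * (C * ((1 - r) ^ (m + 1))⁻¹)) := by gcongr
      _ = r * (C * (1 - r)⁻¹) * q ^ m := by
        rw [hq, div_pow, pow_succ]
        field_simp
  have hsum : Summable fun m : ℕ =>
      ‖(u + 1) ^ m * circleMean r (fun v => g v * ((v + 1) ^ (m + 1))⁻¹)‖ :=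
    Summable.of_nonneg_of_le (fun _ => norm_nonneg _) hterm
      ((summable_geometric_of_lt_one hq0 hq1).mul_left _)
  refine ⟨hsum, ?_⟩
  rw [hsum.of_norm.hasSum_iff_tendsto_nat]
  have hcontv : ContinuousOn (fun v : ℂ => (v - u)⁻¹) (Metric.sphere 0 r) :=
    (continuousOn_id.sub continuousOn_const).inv₀ hvu
  have hcontm : ∀ m : ℕ, ContinuousOn (fun v : ℂ => ((v + 1) ^ (m + 1))⁻¹) (Metric.sphere 0 r) :=
    fun m => ((continuousOn_id.add continuousOn_const).pow _).inv₀ fun v hv =>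
      pow_ne_zero _ (hv1 v hv)
  -- The finite geometric sum of (u+1)^m / (v+1)^(m+1) is 1/(v-u) minus a remainder carrying
  -- ((u+1)/(v+1))^M, which is at most q^M on the circle.
  have hpart : ∀ M : ℕ, ∑ m ∈ Finset.range M,
      (u + 1) ^ m * circleMean r (fun v => g v * ((v + 1) ^ (m + 1))⁻¹) =
      circleMean r (fun v => g v * (v - u)⁻¹) -
        circleMean r (fun v => g v * (v - u)⁻¹ * ((u + 1) ^ M * ((v + 1) ^ M)⁻¹)) := by
    intro M
    have hcM : ContinuousOn (fun v : ℂ => (u + 1) ^ M * ((v + 1) ^ M)⁻¹) (Metric.sphere 0 r) :=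
      continuousOn_const.mul (((continuousOn_id.add continuousOn_const).pow _).inv₀ fun v hv =>
        pow_ne_zero _ (hv1 v hv))
    rw [← circleMean_sub hr0 (hg.fun_mul hcontv) ((hg.fun_mul hcontv).fun_mul hcM)]
    simp_rw [← circleMean_const_mul]
    rw [← circleMean_sum hr0 (Finset.range M)
      (f := fun m v => (u + 1) ^ m * (g v * ((v + 1) ^ (m + 1))⁻¹))
      fun m _ => continuousOn_const.mul (hg.mul (hcontm m))]
    refine circleMean_congr hr0 fun v hv => ?_
    have h1 := hv1 v hv
    have h2 := hvu v hv
    induction M with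
    | zero => simp
    | succ M ih =>
      rw [Finset.sum_range_succ, ih (by
        exact continuousOn_const.mul (((continuousOn_id.add continuousOn_const).pow _).inv₀
          fun v hv => pow_ne_zero _ (hv1 v hv)))]
      field_simp
      ring
  simp_rw [hpart]
  obtain ⟨D, hD⟩ := (isCompact_sphere (0 : ℂ) r).exists_bound_of_continuousOn (hg.mul hcontv)
  have hlim : Filter.Tendsto (fun M : ℕ =>
      circleMean r (fun v => g v * (v - u)⁻¹ * ((u + 1) ^ M * ((v + 1) ^ M)⁻¹)))
      Filter.atTop (nhds 0) := by
    have hD0 : 0 ≤ D := by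
      refine (norm_nonneg _).trans (hD (r : ℂ) ?_)
      rw [mem_sphere_zero_iff_norm, Complex.norm_real, Real.norm_of_nonneg hr0.le]
    refine squeeze_zero_norm (a := fun M : ℕ => r * D * q ^ M) (fun M => ?_) ?_
    · have := norm_circleMean_le (C := D * q ^ M) hr0 (f := fun v =>
        g v * (v - u)⁻¹ * ((u + 1) ^ M * ((v + 1) ^ M)⁻¹)) fun v hv => by
          rw [norm_mul]
          have h2 := one_sub_le_norm_add_one hv
          have h3 : ‖(u + 1) ^ M * ((v + 1) ^ M)⁻¹‖ ≤ q ^ M := by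
            rw [norm_mul, norm_inv, norm_pow, norm_pow, hq, div_pow, div_eq_mul_inv]
            gcongr
          gcongr
          exact hD v hv
      linarith
    · simpa using (tendsto_pow_atTop_nhds_zero_of_lt_one hq0 hq1).const_mul (r * D)
  simpa using hlim.const_sub (circleMean r (fun v => g v * (v - u)⁻¹))

/-- The polynomial `w ^ N * (w + 1) ^ (L - N) * betheFun Y j w`. -/
def betheNumer {N : ℕ} (L : ℕ) (Y : Fin N → ℤ) (j : Fin N) : ℂ[X] :=
  X ^ (N - 1 - j) * (X + 1) ^ ((L : ℤ) - N + (Y j + ((j : ℤ) + 1))).toNat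

theorem eval_betheNumer {N L : ℕ} (hNL : N < L) {Y : Fin N → ℤ} {j : Fin N}
    (hj : (N : ℤ) - L ≤ Y j + ((j : ℤ) + 1)) {w : ℂ} (hw : w ≠ 0) (hw1 : w + 1 ≠ 0) :
    (betheNumer L Y j).eval w = w ^ N * (w + 1) ^ (L - N) * betheFun Y j w := by
  have h1 : w ^ (N - 1 - (j : ℕ)) = w ^ N * w ^ (-((j : ℤ) + 1)) := by
    rw [← zpow_natCast, ← zpow_natCast, ← zpow_add₀ hw]
    congr 1
    have := j.2
    omega
  have h2 : (w + 1) ^ ((L : ℤ) - N + (Y j + ((j : ℤ) + 1))).toNat =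
      (w + 1) ^ (L - N) * (w + 1) ^ (Y j + ((j : ℤ) + 1)) := by
    rw [← zpow_natCast, ← zpow_natCast, ← zpow_add₀ hw1]
    congr 1
    omega
  simp only [betheNumer, eval_mul, eval_pow, eval_X, eval_add, eval_one, h1, h2, betheFun]
  ring

/-- The upper label bound caps the second exponent at L - N, so with the zero-based index the total
is at most L - 1 - j. -/
theorem degree_betheNumer_lt {N L : ℕ} (hNL : N < L) {Y : Fin N → ℤ} {j : Fin N}
    (hj : (N : ℤ) - L ≤ Y j + ((j : ℤ) + 1) ∧ Y j + ((j : ℤ) + 1) ≤ 0) :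
    (betheNumer L Y j).degree < L := by
  have h1 : ((X : ℂ[X]) + 1).natDegree = 1 := natDegree_X_add_C 1
  have h2 : (betheNumer L Y j).natDegree ≤
      (N - 1 - j) + ((L : ℤ) - N + (Y j + ((j : ℤ) + 1))).toNat := by
    refine natDegree_mul_le.trans (add_le_add (natDegree_X_pow_le _) ?_)
    refine natDegree_pow_le.trans ?_
    rw [h1, mul_one]
  refine (degree_le_natDegree).trans_lt ?_
  have := j.2
  exact_mod_cast h2.trans_lt (by omega)

/-- The hitting expectation function as a sum of `N` products, up to a term of order `N` in
`v`. -/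
theorem exists_hasSum_hitGen (B : ℤ) {N : ℕ} (hN : 0 < N) {Y : Fin N → ℤ} (hY : StrictAnti Y)
    (hB : ∀ i, B ≤ Y i) : ∃ (j : Fin N) (R : ℂ → ℂ), DifferentiableOn ℂ R (Metric.ball 0 1) ∧
    ∀ {v u : ℂ}, 1 + v ≠ 0 → 1 + u ≠ 0 → u ≠ 0 → ‖1 + u‖ < ‖1 + v‖ →
    HasSum (fun x : ℤ => (1 + u) ^ x * hitGen B v N Y x)
      (-∑ k, betheFun Y k u * dualFun B v N Y k + v ^ N * betheFun Y j u * R v / (v - u)) := by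
  obtain ⟨n, rfl⟩ := Nat.exists_eq_succ_of_ne_zero hN.ne'
  exact ⟨Fin.last n, fun v => (1 + v) ^ (-Y (Fin.last n) - (n + 1)),
    differentiableOn_one_add_zpow _, fun hv hu hu0 huv => hasSum_hitGen B hv hu hu0 huv hY hB⟩

theorem summable_chTerm {ρ : ℝ} (hρ0 : 0 < ρ) (hρ1 : ρ < 1) {N : ℕ} (hN : 0 < N) {B : ℤ}
    {Y : Fin N → ℤ} (hB : ∀ i, B ≤ Y i) {v u : ℂ} (hv : 1 + v ≠ 0)
    (huv : ‖1 + u‖ < ‖1 + v‖) : Summable (chTerm ρ Y v u) := by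
  have h : chTerm ρ Y v u = fun x => (1 + u) ^ x * hitGen B v N Y x :=
    funext fun x => chTerm_eq hρ0 hρ1 B v u hB x
  rw [h]
  by_cases hu : 1 + u = 0
  -- At u = -1 only the term x = 0 survives.
  · refine summable_of_ne_finset_zero (s := {0}) fun x hx => ?_
    rw [hu, zero_zpow x (by simpa using hx), zero_mul]
  · obtain ⟨n, rfl⟩ := Nat.exists_eq_succ_of_ne_zero hN.ne'
    exact summable_hitGen B hv hu huv hB

section Kernel

variable {N L : ℕ} {z : ℂ} {Y : Fin N → ℤ} {B : ℤ} {r : ℝ}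

/-- The numerator of the kernel integrand over the Bethe polynomial in `u`, with
`x = -m` and `y = -n`. -/
def kernelNumer (L : ℕ) (Y : Fin N → ℤ) (z : ℂ) (B : ℤ) (j : Fin N) (R : ℂ → ℂ) (m n : ℕ)
    (v u : ℂ) : ℂ :=
  z ^ L * (u + 1) ^ m * (-∑ k, (betheNumer L Y k).eval u * dualFun B v N Y k +
    v ^ N * (betheNumer L Y j).eval u * R v / (v - u)) *
    ((v ^ N * (v + 1) ^ (L - N))⁻¹ * ((v + 1) ^ (n + 1))⁻¹)

theorem sub_ne_zero_of_mem (hr : r < density N L) {v u : ℂ} (hv : v ∈ Metric.closedBall (0 : ℂ) r)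
    (hu : u ∈ Metric.ball (-1 : ℂ) (1 - density N L)) : v - u ≠ 0 := by
  intro h
  obtain rfl := sub_eq_zero.mp h
  rw [mem_closedBall_zero_iff] at hv
  rw [mem_ball_iff_norm, sub_neg_eq_add] at hu
  have := norm_sub_le (v + 1) v
  rw [add_sub_cancel_left, norm_one] at this
  linarith

theorem ne_zero_of_mem_ball (hN : 0 < N) (hNL : N < L) {u : ℂ}
    (hu : u ∈ Metric.ball (-1 : ℂ) (1 - density N L)) : u ≠ 0 := by
  rintro rfl
  rw [mem_ball_iff_norm, sub_neg_eq_add, zero_add, norm_one] at hu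
  linarith [density_pos hN hNL]

theorem norm_one_add_lt (hr : r < density N L) {v u : ℂ} (hv : v ∈ Metric.sphere (0 : ℂ) r)
    (hu : u ∈ Metric.ball (-1 : ℂ) (1 - density N L)) : ‖1 + u‖ < ‖1 + v‖ := by
  rw [mem_ball_iff_norm, sub_neg_eq_add, add_comm] at hu
  have := one_sub_le_norm_add_one hv
  rw [add_comm v 1] at this
  linarith

/-- Off u = -1 the series for `ch` has its closed form, and the factor Q(u) of the integrand turns
each b_k(u) into a polynomial. The quotient is then holomorphic across -1 as well. -/
theorem kernelIntegrand_eq (hN : 0 < N) (hNL : N < L)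
    (hlabel : ∀ j : Fin N, (N : ℤ) - L ≤ Y j + ((j : ℤ) + 1)) (hB : ∀ i, B ≤ Y i)
    (hr : r < density N L) {j : Fin N} {R : ℂ → ℂ}
    (hsum : ∀ {v u : ℂ}, 1 + v ≠ 0 → 1 + u ≠ 0 → u ≠ 0 → ‖1 + u‖ < ‖1 + v‖ →
      HasSum (fun x : ℤ => (1 + u) ^ x * hitGen B v N Y x)
        (-∑ k, betheFun Y k u * dualFun B v N Y k + v ^ N * betheFun Y j u * R v / (v - u)))
    (x y : NonposInt) {v u : ℂ} (hv : v ∈ Metric.sphere (0 : ℂ) r)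
    (hu : u ∈ Metric.ball (-1 : ℂ) (1 - density N L)) (hu1 : u ≠ -1) :
    kernelIntegrand L Y z x y v u =
      kernelNumer L Y z B j R (-x.1).toNat (-y.1).toNat v u *
        (u ^ N * (u + 1) ^ (L - N) - z ^ L)⁻¹ := by
  have hr1 : r < 1 := hr.trans (density_lt_one hNL)
  have hv1 : 1 + v ≠ 0 := one_add_ne_zero_of_mem_ball (sphere_subset_unit_ball hr1 hv)
  have hu1' : 1 + u ≠ 0 := fun h => hu1 (eq_neg_of_add_eq_zero_right h)
  have hu0 := ne_zero_of_mem_ball hN hNL hu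
  have hch : ch (density N L) Y v u =
      -∑ k, betheFun Y k u * dualFun B v N Y k + v ^ N * betheFun Y j u * R v / (v - u) := by
    rw [ch, ← (hsum hv1 hu1' hu0 (norm_one_add_lt hr hv hu)).tsum_eq]
    exact tsum_congr fun x => chTerm_eq (density_pos hN hNL) (density_lt_one hNL) B v u hB x
  have hxpow : (u + 1) ^ ((L : ℤ) - N - x) = (u + 1) ^ (L - N) * (u + 1) ^ (-x.1).toNat := by
    rw [← pow_add, ← zpow_natCast]
    congr 1
    have := x.2
    omega
  have hypow : (v + 1) ^ ((L : ℤ) - N - y + 1) =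
      (v + 1) ^ (L - N) * (v + 1) ^ ((-y.1).toNat + 1) := by
    rw [← pow_add, ← zpow_natCast]
    congr 1
    have := y.2
    omega
  rw [add_comm] at hu1'
  rw [kernelIntegrand, kernelNumer, hch, hxpow, hypow]
  simp_rw [fun k => eval_betheNumer hNL (hlabel k) hu0 hu1', mul_assoc (u ^ N * (u + 1) ^ (L - N)),
    ← Finset.mul_sum]
  rw [div_eq_mul_inv, div_eq_mul_inv, div_eq_mul_inv, div_eq_mul_inv]
  simp only [mul_inv]
  ring

theorem differentiableOn_kernelNumer (hr : r < density N L) {j : Fin N} {R : ℂ → ℂ} (m n : ℕ)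
    {v : ℂ} (hv : v ∈ Metric.sphere (0 : ℂ) r) :
    DifferentiableOn ℂ (kernelNumer L Y z B j R m n v)
      (Metric.ball (-1 : ℂ) (1 - density N L)) := by
  unfold kernelNumer
  have h1 : DifferentiableOn ℂ (fun u : ℂ => v ^ N * (betheNumer L Y j).eval u * R v / (v - u))
      (Metric.ball (-1 : ℂ) (1 - density N L)) := by
    refine DifferentiableOn.div (by fun_prop) (by fun_prop) fun u hu => ?_
    exact sub_ne_zero_of_mem hr (Metric.sphere_subset_closedBall hv) hu
  fun_prop

theorem continuousOn_kernelNumer (hNL : N < L) (hr0 : 0 < r) (hr : r < density N L) {j : Fin N}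
    {R : ℂ → ℂ} (hR : DifferentiableOn ℂ R (Metric.ball 0 1)) (m n : ℕ) {u : ℂ}
    (hu : u ∈ Metric.ball (-1 : ℂ) (1 - density N L)) :
    ContinuousOn (fun v => kernelNumer L Y z B j R m n v u) (Metric.sphere 0 r) := by
  have hr1 : r < 1 := hr.trans (density_lt_one hNL)
  have hsub := sphere_subset_unit_ball hr1
  have h1 : ∀ v ∈ Metric.sphere (0 : ℂ) r, v + 1 ≠ 0 := fun v hv => by
    rw [add_comm]
    exact one_add_ne_zero_of_mem_ball (hsub hv)
  have h2 : ∀ k, ContinuousOn (fun v => dualFun B v N Y k) (Metric.sphere 0 r) := fun k =>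
    (differentiableOn_dualFun B Y k).continuousOn.mono hsub
  have h3 : ContinuousOn R (Metric.sphere 0 r) := hR.continuousOn.mono hsub
  have h4 : ContinuousOn (fun v : ℂ => v ^ N * (betheNumer L Y j).eval u * R v / (v - u))
      (Metric.sphere 0 r) :=
    ContinuousOn.div (by fun_prop) (by fun_prop) fun v hv =>
      sub_ne_zero_of_mem hr (Metric.sphere_subset_closedBall hv) hu
  have h5 : ContinuousOn (fun v : ℂ => (v ^ N * (v + 1) ^ (L - N))⁻¹) (Metric.sphere 0 r) :=
    ContinuousOn.inv₀ (by fun_prop) fun v hv =>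
      mul_ne_zero (pow_ne_zero _ (ne_zero_of_mem_sphere hr0 hv)) (pow_ne_zero _ (h1 v hv))
  have h6 : ContinuousOn (fun v : ℂ => ((v + 1) ^ (n + 1))⁻¹) (Metric.sphere 0 r) :=
    ContinuousOn.inv₀ (by fun_prop) fun v hv => pow_ne_zero _ (h1 v hv)
  unfold kernelNumer
  fun_prop

/-- The weight `φ_k(v) / (v ^ N * (v + 1) ^ (L - N))` of the dual functionals. -/
def dualWeight (L : ℕ) (B : ℤ) (Y : Fin N → ℤ) (k : Fin N) (v : ℂ) : ℂ :=
  dualFun B v N Y k * (v ^ N * (v + 1) ^ (L - N))⁻¹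

theorem continuousOn_dualWeight (hr0 : 0 < r) (hr1 : r < 1) (k : Fin N) :
    ContinuousOn (dualWeight L B Y k) (Metric.sphere 0 r) := by
  have hsub := sphere_subset_unit_ball hr1
  have h1 : ∀ v ∈ Metric.sphere (0 : ℂ) r, v + 1 ≠ 0 := fun v hv => by
    rw [add_comm]
    exact one_add_ne_zero_of_mem_ball (hsub hv)
  refine ((differentiableOn_dualFun B Y k).continuousOn.mono hsub).mul
    (ContinuousOn.inv₀ (by fun_prop) fun v hv => ?_)
  exact mul_ne_zero (pow_ne_zero _ (ne_zero_of_mem_sphere hr0 hv)) (pow_ne_zero _ (h1 v hv))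

/-- The remainder term carries v^N, which removes the pole at 0. The points v = u and v = -1 lie
outside the closed disc of radius `r`, so its mean vanishes. -/
theorem circleMean_kernelNumer (hNL : N < L) (hr0 : 0 < r) (hr : r < density N L) {j : Fin N}
    {R : ℂ → ℂ} (hR : DifferentiableOn ℂ R (Metric.ball 0 1)) (m n : ℕ) {u : ℂ}
    (hu : u ∈ Metric.ball (-1 : ℂ) (1 - density N L)) :
    circleMean r (fun v => kernelNumer L Y z B j R m n v u) =
      -∑ k, z ^ L * (u + 1) ^ m * (betheNumer L Y k).eval u *
        circleMean r (fun v => dualWeight L B Y k v * ((v + 1) ^ (n + 1))⁻¹) := by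
  have hr1 : r < 1 := hr.trans (density_lt_one hNL)
  have hsub := sphere_subset_unit_ball hr1
  have hsub' : Metric.closedBall (0 : ℂ) r ⊆ Metric.ball 0 1 := Metric.closedBall_subset_ball hr1
  have h1 : ∀ v ∈ Metric.closedBall (0 : ℂ) r, v + 1 ≠ 0 := fun v hv => by
    rw [add_comm]
    exact one_add_ne_zero_of_mem_ball (hsub' hv)
  have hrem : DifferentiableOn ℂ (fun v => z ^ L * (u + 1) ^ m * (betheNumer L Y j).eval u *
      (R v * (v - u)⁻¹ * ((v + 1) ^ (L - N))⁻¹ * ((v + 1) ^ (n + 1))⁻¹))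
      (Metric.closedBall 0 r) := by
    have h2 : DifferentiableOn ℂ R (Metric.closedBall 0 r) := hR.mono hsub'
    have h3 : DifferentiableOn ℂ (fun v : ℂ => (v - u)⁻¹) (Metric.closedBall 0 r) :=
      DifferentiableOn.inv (by fun_prop) fun v hv => sub_ne_zero_of_mem hr hv hu
    have h4 : ∀ k : ℕ, DifferentiableOn ℂ (fun v : ℂ => ((v + 1) ^ k)⁻¹)
        (Metric.closedBall 0 r) := fun k =>
      DifferentiableOn.inv (by fun_prop) fun v hv => pow_ne_zero _ (h1 v hv)
    exact (differentiableOn_const _).mul (((h2.mul h3).mul (h4 _)).mul (h4 _))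
  have hcont : ∀ k, ContinuousOn (fun v => -(z ^ L * (u + 1) ^ m * (betheNumer L Y k).eval u) *
      (dualWeight L B Y k v * ((v + 1) ^ (n + 1))⁻¹)) (Metric.sphere 0 r) := fun k =>
    continuousOn_const.mul ((continuousOn_dualWeight hr0 hr1 k).mul
      (ContinuousOn.inv₀ (by fun_prop) fun v hv =>
        pow_ne_zero _ (h1 v (Metric.sphere_subset_closedBall hv))))
  rw [circleMean_congr hr0 (g := fun v => (∑ k, -(z ^ L * (u + 1) ^ m *
    (betheNumer L Y k).eval u) * (dualWeight L B Y k v * ((v + 1) ^ (n + 1))⁻¹)) +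
    z ^ L * (u + 1) ^ m * (betheNumer L Y j).eval u *
      (R v * (v - u)⁻¹ * ((v + 1) ^ (L - N))⁻¹ * ((v + 1) ^ (n + 1))⁻¹))]
  · rw [circleMean_add hr0 (continuousOn_finsetSum _ fun k _ => hcont k)
      (hrem.continuousOn.mono Metric.sphere_subset_closedBall),
      circleMean_eq_zero_of_closedBall hr0 hrem, add_zero, circleMean_sum hr0 _ fun k _ => hcont k,
      ← Finset.sum_neg_distrib]
    refine Finset.sum_congr rfl fun k _ => ?_
    rw [circleMean_const_mul]
    ring
  · intro v hv
    have hv0 := pow_ne_zero N (ne_zero_of_mem_sphere hr0 hv)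
    simp only [kernelNumer, dualWeight]
    have hS : ∑ k, -(z ^ L * (u + 1) ^ m * (betheNumer L Y k).eval u) *
        (dualFun B v N Y k * (v ^ N * (v + 1) ^ (L - N))⁻¹ * ((v + 1) ^ (n + 1))⁻¹) =
        -(z ^ L * (u + 1) ^ m * (v ^ N * (v + 1) ^ (L - N))⁻¹ * ((v + 1) ^ (n + 1))⁻¹) *
          ∑ k, (betheNumer L Y k).eval u * dualFun B v N Y k := by
      rw [Finset.mul_sum]
      exact Finset.sum_congr rfl fun k _ => by ring
    rw [hS, mul_inv, div_eq_mul_inv]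
    have : v ^ N * (v ^ N)⁻¹ = 1 := mul_inv_cancel₀ hv0
    linear_combination (z ^ L * (u + 1) ^ m * (betheNumer L Y j).eval u *
      (R v * (v - u)⁻¹ * ((v + 1) ^ (L - N))⁻¹ * ((v + 1) ^ (n + 1))⁻¹)) * this

variable {c : ℂ} {γ : Path c c}

theorem mem_ball_of_mem_leftRoots (hN : 0 < N) (hNL : N < L) (hz : ‖z‖ < critRadius N L) {u : ℂ}
    (hu : u ∈ leftRoots N L z) : u ∈ Metric.ball (-1 : ℂ) (1 - density N L) := by
  rw [mem_ball_iff_norm, sub_neg_eq_add]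
  exact (norm_lt_of_mem_leftRoots hN hNL hz hu).1

/-- The integrals in the kernel converge, and the kernel has rank at most `N`. -/
theorem energyKernel_eq (hN : 0 < N) (hNL : N < L)
    (hlabel : ∀ j : Fin N, (N : ℤ) - L ≤ Y j + ((j : ℤ) + 1)) (hB : ∀ i, B ≤ Y i)
    (hz0 : z ≠ 0) (hz : ‖z‖ < critRadius N L) (hγ : IsLeftContour N L z γ)
    (hr0 : 0 < r) (hr : r < density N L) (hY : StrictAnti Y) (x y : NonposInt) :
    (∀ v ∈ Metric.sphere (0 : ℂ) r, CurveIntegrable (form (kernelIntegrand L Y z x y v)) γ) ∧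
    CircleIntegrable (innerIntegral L Y z γ x y) 0 r ∧
    energyKernel L Y z γ r x y = ∑ k, (-∑ u ∈ leftRoots N L z, z ^ L *
        ((derivative (bethePoly N L z)).eval u)⁻¹ * (betheNumer L Y k).eval u *
        (u + 1) ^ (-x.1).toNat) *
      circleMean r (fun v => dualWeight L B Y k v * ((v + 1) ^ ((-y.1).toNat + 1))⁻¹) := by
  obtain ⟨j, R, hR, hsum⟩ := exists_hasSum_hitGen B hN hY hB
  -- A simple contour meets -1 at countably many times, so the closed form may replace the
  -- integrand.
  have hcongr := fun v (hv : v ∈ Metric.sphere (0 : ℂ) r) =>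
    contourIntegral_congr_of_countable (γ := γ) (f := kernelIntegrand L Y z x y v)
      (g := fun u => kernelNumer L Y z B j R (-x.1).toNat (-y.1).toNat v u *
        (u ^ N * (u + 1) ^ (L - N) - z ^ L)⁻¹) (hγ.countable_preimage (-1)) fun t ht =>
      kernelIntegrand_eq hN hNL hlabel hB hr hsum x y hv (hγ.mem_ball hN hNL t) fun h =>
        ht ⟨t.2, h⟩
  have hinner : Set.EqOn (innerIntegral L Y z γ x y) (fun v => ∑ u ∈ leftRoots N L z,
      ((derivative (bethePoly N L z)).eval u)⁻¹ *
        kernelNumer L Y z B j R (-x.1).toNat (-y.1).toNat v u) (Metric.sphere 0 r) := by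
    intro v hv
    change contourIntegral γ (kernelIntegrand L Y z x y v) = _
    rw [(hcongr v hv).1, hγ.contourIntegral_div hN hNL hz0 hz
      (differentiableOn_kernelNumer hr _ _ hv)]
    exact Finset.sum_congr rfl fun u _ => mul_comm _ _
  have hcont : ∀ u ∈ leftRoots N L z, ContinuousOn (fun v =>
      ((derivative (bethePoly N L z)).eval u)⁻¹ *
        kernelNumer L Y z B j R (-x.1).toNat (-y.1).toNat v u) (Metric.sphere 0 r) :=
    fun u hu => continuousOn_const.mul (continuousOn_kernelNumer hNL hr0 hr hR _ _
      (mem_ball_of_mem_leftRoots hN hNL hz hu))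
  refine ⟨fun v hv => ?_, ?_, ?_⟩
  · rw [(hcongr v hv).2]
    exact hγ.curveIntegrable_div hN hNL (differentiableOn_kernelNumer hr _ _ hv).continuousOn
  · refine ContinuousOn.circleIntegrable hr0.le ?_
    exact (continuousOn_finsetSum _ hcont).congr hinner
  · change circleMean r (innerIntegral L Y z γ x y) = _
    rw [circleMean_congr hr0 hinner, circleMean_sum hr0 _ hcont]
    simp_rw [← Finset.sum_neg_distrib, Finset.sum_mul]
    rw [Finset.sum_comm]
    refine Finset.sum_congr rfl fun u hu => ?_
    rw [circleMean_const_mul, circleMean_kernelNumer hNL hr0 hr hR _ _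
      (mem_ball_of_mem_leftRoots hN hNL hz hu), ← Finset.sum_neg_distrib, Finset.mul_sum]
    exact Finset.sum_congr rfl fun k _ => by ring

end Kernel

/-! ### The determinant of the finite rank kernel -/

/-- The nonpositive integers as a copy of the natural numbers. -/
def nonposIntEquiv : NonposInt ≃ ℕ where
  toFun x := (-x.1).toNat
  invFun n := ⟨-n, by omega⟩
  left_inv x := Subtype.ext (by have := x.2; simp only; omega)
  right_inv n := by simp

section DualPairing

variable {N L : ℕ} {z : ℂ} {Y : Fin N → ℤ} {B : ℤ} {r : ℝ}

/-- The linear functional on polynomials that is dual to `betheNumer L Y k`. -/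
def dualPairing (L : ℕ) (B : ℤ) (Y : Fin N → ℤ) (r : ℝ) (k : Fin N) (p : ℂ[X]) : ℂ :=
  circleMean r fun v => p.eval v * dualWeight L B Y k v

theorem dualPairing_betheNumer (hNL : N < L) (hY : StrictAnti Y) (hB : ∀ i, B ≤ Y i)
    (hlabel : ∀ j : Fin N, (N : ℤ) - L ≤ Y j + ((j : ℤ) + 1)) (hr0 : 0 < r) (hr1 : r < 1)
    (j k : Fin N) : dualPairing L B Y r k (betheNumer L Y j) = if j = k then 1 else 0 := by
  rw [← circleMean_betheFun_dualFun B hr0 hr1 hY hB j k]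
  refine circleMean_congr hr0 fun v hv => ?_
  have h0 := ne_zero_of_mem_sphere hr0 hv
  have h1 : v + 1 ≠ 0 := by
    rw [add_comm]
    exact one_add_ne_zero_of_mem_ball (sphere_subset_unit_ball hr1 hv)
  simp only [eval_betheNumer hNL (hlabel j) h0 h1, dualWeight]
  field_simp

/-- The basis polynomial is (Q - z^L) / (P'(u)(v-u)). Its part with Q cancels the denominator of the
weight and is holomorphic inside the circle, so only the part with z^L remains. -/
theorem dualPairing_basis (hN : 0 < N) (hNL : N < L) (hz0 : z ≠ 0) (hz : ‖z‖ < critRadius N L)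
    (hr0 : 0 < r) (hr : r < density N L) (k : Fin N) {u : ℂ} (hu : u ∈ leftRoots N L z) :
    dualPairing L B Y r k (Lagrange.basis (betheRoots N L z) id u) =
      -(z ^ L * ((derivative (bethePoly N L z)).eval u)⁻¹ *
        circleMean r fun v => dualWeight L B Y k v * (v - u)⁻¹) := by
  have hr1 : r < 1 := hr.trans (density_lt_one hNL)
  have hu' := mem_ball_of_mem_leftRoots hN hNL hz hu
  have hsub' : Metric.closedBall (0 : ℂ) r ⊆ Metric.ball 0 1 := Metric.closedBall_subset_ball hr1
  have hinv : DifferentiableOn ℂ (fun v : ℂ => (v - u)⁻¹) (Metric.closedBall 0 r) :=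
    DifferentiableOn.inv (by fun_prop) fun v hv => sub_ne_zero_of_mem hr hv hu'
  have h1 : DifferentiableOn ℂ (fun v => ((derivative (bethePoly N L z)).eval u)⁻¹ *
      (dualFun B v N Y k * (v - u)⁻¹)) (Metric.closedBall 0 r) :=
    (differentiableOn_const _).mul (((differentiableOn_dualFun B Y k).mono hsub').mul hinv)
  have h2 : ContinuousOn (fun v => z ^ L * ((derivative (bethePoly N L z)).eval u)⁻¹ *
      (dualWeight L B Y k v * (v - u)⁻¹)) (Metric.sphere 0 r) :=
    continuousOn_const.mul ((continuousOn_dualWeight hr0 hr1 k).mul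
      (hinv.continuousOn.mono Metric.sphere_subset_closedBall))
  rw [dualPairing, circleMean_congr hr0 (g := fun v =>
    ((derivative (bethePoly N L z)).eval u)⁻¹ * (dualFun B v N Y k * (v - u)⁻¹) -
    z ^ L * ((derivative (bethePoly N L z)).eval u)⁻¹ * (dualWeight L B Y k v * (v - u)⁻¹)),
    circleMean_sub hr0 (h1.continuousOn.mono Metric.sphere_subset_closedBall) h2,
    circleMean_eq_zero_of_closedBall hr0 h1, circleMean_const_mul, zero_sub]
  intro v hv
  have hv0 := ne_zero_of_mem_sphere hr0 hv
  have hv1 : v + 1 ≠ 0 := by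
    rw [add_comm]
    exact one_add_ne_zero_of_mem_ball (sphere_subset_unit_ball hr1 hv)
  have hvu := sub_ne_zero_of_mem hr (Metric.sphere_subset_closedBall hv) hu'
  simp only [eval_basis_eq hN hNL hz0 hz (Finset.mem_filter.mp hu).1 (sub_ne_zero.mp hvu),
    dualWeight]
  rw [div_eq_mul_inv, mul_inv]
  have h3 : v ^ N * (v + 1) ^ (L - N) * (v ^ N * (v + 1) ^ (L - N))⁻¹ = 1 :=
    mul_inv_cancel₀ (mul_ne_zero (pow_ne_zero _ hv0) (pow_ne_zero _ hv1))
  linear_combination (((derivative (bethePoly N L z)).eval u)⁻¹ * (v - u)⁻¹ *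
    dualFun B v N Y k) * h3

theorem dualPairing_eq_sum (hN : 0 < N) (hNL : N < L) (hz0 : z ≠ 0) (hz : ‖z‖ < critRadius N L)
    (hr0 : 0 < r) (hr1 : r < 1) (k : Fin N) {p : ℂ[X]} (hp : p.degree < L) :
    dualPairing L B Y r k p = ∑ w ∈ betheRoots N L z,
      p.eval w * dualPairing L B Y r k (Lagrange.basis (betheRoots N L z) id w) := by
  simp only [dualPairing]
  simp_rw [← circleMean_const_mul]
  rw [← circleMean_sum hr0]
  · refine circleMean_congr hr0 fun v _ => ?_
    simp only [eval_eq_sum_basis hN hNL hz0 hz hp v, Finset.sum_mul, mul_assoc]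
  · exact fun w _ => continuousOn_const.mul ((Polynomial.continuousOn _).mul
      (continuousOn_dualWeight hr0 hr1 k))

/-- Since φ_k vanishes to order `k` with leading coefficient 1, the integrand behaves like q(v)
v^(k-j-1): a simple pole for j = k, none for j < k. -/
theorem dualPairing_mul_X_pow (hr0 : 0 < r) (hr1 : r < 1) (q : ℂ[X]) {j k : Fin N} (hjk : j ≤ k) :
    dualPairing L B Y r k (q * X ^ (N - 1 - j)) = if j = k then q.eval 0 else 0 := by
  obtain ⟨ψ, h1, h2, h3⟩ := exists_dualFun_eq B Y k
  have hd : DifferentiableOn ℂ (fun v => q.eval v * v ^ ((k : ℕ) - j) * ψ v *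
      (1 + v) ^ (-((L - N : ℕ) : ℤ))) (Metric.ball 0 1) :=
    (((Polynomial.differentiable q).differentiableOn.mul
      (differentiableOn_id.pow _)).mul h1).mul (differentiableOn_one_add_zpow _)
  rw [dualPairing, circleMean_congr hr0 (g := fun v => v⁻¹ *
    (q.eval v * v ^ ((k : ℕ) - j) * ψ v * (1 + v) ^ (-((L - N : ℕ) : ℤ)))),
    circleMean_inv_mul hr0 hr1 hd]
  · rcases hjk.eq_or_lt with rfl | hlt
    · simp [h2]
    · rw [if_neg hlt.ne, zero_pow (by omega)]
      simp
  · intro v hv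
    have hv0 := ne_zero_of_mem_sphere hr0 hv
    have hv1 := one_add_ne_zero_of_mem_ball (sphere_subset_unit_ball hr1 hv)
    simp only [dualWeight, h3, eval_mul, eval_pow, eval_X, add_comm v 1, zpow_neg, zpow_natCast]
    have h4 : v ^ (N - 1 - (j : ℕ)) * v ^ (k : ℕ) * v = v ^ N * v ^ ((k : ℕ) - j) := by
      rw [← pow_add, ← pow_succ, ← pow_add]
      congr 1
      have := k.2
      have : (j : ℕ) ≤ k := hjk
      omega
    field_simp
    linear_combination (q.eval v * ψ v) * h4

/-- The polynomial whose roots are the left Bethe roots. -/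
def leftPoly (N L : ℕ) (z : ℂ) : ℂ[X] := ∏ u ∈ leftRoots N L z, (X - C u)

theorem eval_leftPoly (w : ℂ) : (leftPoly N L z).eval w = ∏ u ∈ leftRoots N L z, (w - u) := by
  simp [leftPoly, eval_prod]

theorem card_leftRoots (hN : 0 < N) (hNL : N < L) (hz0 : z ≠ 0) (hz : ‖z‖ < critRadius N L) :
    (leftRoots N L z).card = L - N := by
  have h1 := card_betheRoots hN hNL hz0 hz
  rw [betheRoots_eq_union hN hNL hz, Finset.card_union_of_disjoint disjoint_rightRoots_leftRoots,
    card_rightRoots hN hNL hz0 hz] at h1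
  omega

theorem degree_leftPoly_mul_lt (hN : 0 < N) (hNL : N < L) (hz0 : z ≠ 0)
    (hz : ‖z‖ < critRadius N L) (j : Fin N) :
    degree (leftPoly N L z * X ^ (N - 1 - (j : ℕ))) < (L : WithBot ℕ) := by
  have h : (leftPoly N L z).natDegree = L - N := by
    rw [leftPoly, natDegree_prod_of_monic _ _ fun u _ => monic_X_sub_C u]
    simp [card_leftRoots hN hNL hz0 hz]
  have h2 : (leftPoly N L z * X ^ (N - 1 - (j : ℕ))).natDegree ≤ L - N + (N - 1 - j) :=
    natDegree_mul_le.trans (add_le_add h.le (natDegree_X_pow_le _))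
  have h3 : L - N + (N - 1 - (j : ℕ)) < L := by
    have := j.2
    omega
  exact degree_le_natDegree.trans_lt (by exact_mod_cast h2.trans_lt h3)

variable {c : ℂ} {γ : Path c c}

/-- The values at the right Bethe roots of the functionals of the Lagrange basis. -/
def pairingMatrix (L : ℕ) (z : ℂ) (B : ℤ) (Y : Fin N → ℤ) (r : ℝ)
    (e : Fin N ≃ rightRoots N L z) : Matrix (Fin N) (Fin N) ℂ :=
  Matrix.of fun k i => dualPairing L B Y r k (Lagrange.basis (betheRoots N L z) id (e i))

theorem sum_rightRoots (e : Fin N ≃ rightRoots N L z) (f : ℂ → ℂ) :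
    ∑ w ∈ rightRoots N L z, f w = ∑ i, f (e i) := by
  rw [← Finset.sum_coe_sort]
  exact (Equiv.sum_comp e fun w => f w).symm

theorem prod_rightRoots (e : Fin N ≃ rightRoots N L z) (f : ℂ → ℂ) :
    ∏ w ∈ rightRoots N L z, f w = ∏ i, f (e i) := by
  rw [← Finset.prod_coe_sort]
  exact (Equiv.prod_comp e fun w => f w).symm

/-- The factors in `x` of the finite rank kernel. -/
def kernelLeft (L : ℕ) (z : ℂ) (Y : Fin N → ℤ) (k : Fin N) (x : NonposInt) : ℂ :=
  -∑ u ∈ leftRoots N L z, z ^ L * ((derivative (bethePoly N L z)).eval u)⁻¹ *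
    (betheNumer L Y k).eval u * (u + 1) ^ (-x.1).toNat

/-- The factors in `y` of the finite rank kernel. -/
def kernelRight (L : ℕ) (B : ℤ) (Y : Fin N → ℤ) (r : ℝ) (k : Fin N) (y : NonposInt) : ℂ :=
  circleMean r fun v => dualWeight L B Y k v * ((v + 1) ^ ((-y.1).toNat + 1))⁻¹

theorem kernelRight_mul_kernelLeft (k l : Fin N) (x : NonposInt) :
    kernelRight L B Y r k x * kernelLeft L z Y l x = ∑ u ∈ leftRoots N L z,
      -(z ^ L * ((derivative (bethePoly N L z)).eval u)⁻¹ * (betheNumer L Y l).eval u) *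
        ((u + 1) ^ (-x.1).toNat * kernelRight L B Y r k x) := by
  rw [kernelLeft, ← Finset.sum_neg_distrib, Finset.mul_sum]
  exact Finset.sum_congr rfl fun u _ => by ring

/-- For a left root |u+1| < 1-ρ < 1-r ≤ |v+1|, so the sum over the lattice is a convergent geometric
series. -/
theorem hasSum_pow_mul_kernelRight (hN : 0 < N) (hNL : N < L) (hz : ‖z‖ < critRadius N L)
    (hr0 : 0 < r) (hr : r < density N L) (k : Fin N) {u : ℂ} (hu : u ∈ leftRoots N L z) :
    (Summable fun x : NonposInt => ‖(u + 1) ^ (-x.1).toNat * kernelRight L B Y r k x‖) ∧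
    HasSum (fun x : NonposInt => (u + 1) ^ (-x.1).toNat * kernelRight L B Y r k x)
      (circleMean r fun v => dualWeight L B Y k v * (v - u)⁻¹) := by
  have hr1 : r < 1 := hr.trans (density_lt_one hNL)
  have h := hasSum_circleMean_geometric hr0 hr1
    (continuousOn_dualWeight (L := L) (B := B) (Y := Y) hr0 hr1 k)
    ((norm_lt_of_mem_leftRoots hN hNL hz hu).1.trans (sub_lt_sub_left hr 1))
  have h1 := nonposIntEquiv.summable_iff.mpr h.1
  have h2 := nonposIntEquiv.hasSum_iff.mpr h.2
  exact ⟨h1, h2⟩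

theorem summable_kernelRight_mul_kernelLeft (hN : 0 < N) (hNL : N < L) (hz : ‖z‖ < critRadius N L)
    (hr0 : 0 < r) (hr : r < density N L) (k l : Fin N) :
    Summable fun x => ‖kernelRight L B Y r k x * kernelLeft L z Y l x‖ := by
  simp_rw [kernelRight_mul_kernelLeft]
  refine Summable.of_nonneg_of_le (fun _ => norm_nonneg _) (fun x => norm_sum_le _ _) ?_
  refine summable_sum fun u hu => ?_
  simp_rw [norm_mul (-_ : ℂ)]
  exact (hasSum_pow_mul_kernelRight hN hNL hz hr0 hr k hu).1.mul_left _

theorem tsum_kernelRight_mul_kernelLeft (hN : 0 < N) (hNL : N < L) (hz0 : z ≠ 0)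
    (hz : ‖z‖ < critRadius N L) (hr0 : 0 < r) (hr : r < density N L) (k l : Fin N) :
    ∑' x, kernelRight L B Y r k x * kernelLeft L z Y l x = ∑ u ∈ leftRoots N L z,
      (betheNumer L Y l).eval u *
        dualPairing L B Y r k (Lagrange.basis (betheRoots N L z) id u) := by
  simp_rw [kernelRight_mul_kernelLeft]
  rw [(hasSum_sum fun u hu =>
    (hasSum_pow_mul_kernelRight hN hNL hz hr0 hr k hu).2.mul_left _).tsum_eq]
  refine Finset.sum_congr rfl fun u hu => ?_
  rw [dualPairing_basis hN hNL hz0 hz hr0 hr k hu]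
  ring

/-- The Fredholm determinant is the determinant of the pairing of the Lagrange basis at the right
Bethe roots with the numerators. -/
theorem fredholm_energyKernel (hN : 0 < N) (hNL : N < L)
    (hlabel : ∀ j : Fin N, (N : ℤ) - L ≤ Y j + ((j : ℤ) + 1) ∧ Y j + ((j : ℤ) + 1) ≤ 0)
    (hB : ∀ i, B ≤ Y i) (hz0 : z ≠ 0) (hz : ‖z‖ < critRadius N L) (hγ : IsLeftContour N L z γ)
    (hr0 : 0 < r) (hr : r < density N L) (hY : StrictAnti Y) (e : Fin N ≃ rightRoots N L z) :
    FredholmConverges (energyKernel L Y z γ r) ∧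
    fredholmDet (energyKernel L Y z γ r) = (pairingMatrix L z B Y r e).det *
      (Matrix.of fun i j : Fin N => (betheNumer L Y j).eval (e i : ℂ)).det := by
  have hr1 : r < 1 := hr.trans (density_lt_one hNL)
  have hfr := fredholm_finiteRank (energyKernel L Y z γ r) (kernelLeft L z Y)
    (kernelRight L B Y r)
    (fun x y => (energyKernel_eq hN hNL (fun j => (hlabel j).1) hB hz0 hz hγ hr0 hr hY x y).2.2)
    (summable_kernelRight_mul_kernelLeft hN hNL hz hr0 hr)
  refine ⟨hfr.1, ?_⟩
  rw [hfr.2, ← Matrix.det_mul]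
  congr 1
  ext k l
  -- Interpolating p_l at all Bethe roots expresses δ_kl. The left roots give the Gram entry, and
  -- subtracting it leaves the sum over right roots, an entry of the matrix product.
  have h1 := dualPairing_eq_sum (B := B) (Y := Y) hN hNL hz0 hz hr0 hr1 k
    (degree_betheNumer_lt hNL (hlabel l))
  rw [dualPairing_betheNumer hNL hY hB (fun j => (hlabel j).1) hr0 hr1,
    betheRoots_eq_union hN hNL hz, Finset.sum_union disjoint_rightRoots_leftRoots,
    ← betheRoots_eq_union hN hNL hz, sum_rightRoots e] at h1
  rw [Matrix.sub_apply, Matrix.of_apply, tsum_kernelRight_mul_kernelLeft hN hNL hz0 hz hr0 hr,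
    Matrix.one_apply, Matrix.mul_apply]
  simp only [eq_comm (a := k), h1, add_sub_cancel_right]
  simp only [pairingMatrix, Matrix.of_apply, mul_comm]

/-- The determinant of the pairing matrix, up to a Vandermonde determinant. -/
theorem det_pairingMatrix_mul (hN : 0 < N) (hNL : N < L) (hz0 : z ≠ 0)
    (hz : ‖z‖ < critRadius N L) (hr0 : 0 < r) (hr1 : r < 1) (e : Fin N ≃ rightRoots N L z) :
    (pairingMatrix L z B Y r e).det * ((∏ i, ∏ u ∈ leftRoots N L z, ((e i : ℂ) - u)) *
      (Matrix.of fun i j : Fin N => (e i : ℂ) ^ (N - 1 - (j : ℕ))).det) =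
      (∏ u ∈ leftRoots N L z, -u) ^ N := by
  -- These have degree below L and vanish at every left root, so their interpolation formula
  -- involves right roots only.
  set t : Fin N → ℂ[X] := fun j => leftPoly N L z * X ^ (N - 1 - (j : ℕ)) with ht
  have hmul : pairingMatrix L z B Y r e * Matrix.of (fun i j : Fin N => (t j).eval (e i : ℂ)) =
      Matrix.of fun k j => dualPairing L B Y r k (t j) := by
    ext k j
    rw [Matrix.mul_apply, Matrix.of_apply, dualPairing_eq_sum hN hNL hz0 hz hr0 hr1 k
      (degree_leftPoly_mul_lt hN hNL hz0 hz j), betheRoots_eq_union hN hNL hz,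
      Finset.sum_union disjoint_rightRoots_leftRoots, ← betheRoots_eq_union hN hNL hz,
      Finset.sum_eq_zero (s := leftRoots N L z), add_zero, sum_rightRoots e]
    · simp only [pairingMatrix, Matrix.of_apply, ht, mul_comm]
    · intro u hu
      rw [eval_mul, eval_leftPoly, Finset.prod_eq_zero hu (sub_self u), zero_mul, zero_mul]
  have hdet : (Matrix.of fun k j => dualPairing L B Y r k (t j)).det =
      (∏ u ∈ leftRoots N L z, -u) ^ N := by
    rw [Matrix.det_of_isUpperTriangular]
    · simp [ht, dualPairing_mul_X_pow hr0 hr1 (leftPoly N L z) le_rfl, eval_leftPoly]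
    · intro k j hjk
      rw [id, id] at hjk
      rw [Matrix.of_apply, dualPairing_mul_X_pow hr0 hr1 _ hjk.le, if_neg hjk.ne]
  rw [← hdet, ← hmul, Matrix.det_mul, ← Matrix.det_mul_column]
  simp only [ht, eval_mul, eval_leftPoly, eval_pow, eval_X, Matrix.of_apply]

/-- Up to row factors it is a Vandermonde determinant in the inverses of distinct nonzero roots. -/
theorem det_zpow_neg_ne_zero (hN : 0 < N) (hNL : N < L) (hz0 : z ≠ 0)
    (e : Fin N ≃ rightRoots N L z) :
    (Matrix.of fun i j : Fin N => (e i : ℂ) ^ (-((j : ℤ) + 1))).det ≠ 0 := by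
  have h0 : ∀ i, (e i : ℂ) ≠ 0 := fun i =>
    (ne_zero_of_mem_betheRoots hN hNL hz0 (Finset.mem_filter.mp (e i).2).1).1
  have h : (Matrix.of fun i j : Fin N => (e i : ℂ) ^ (-((j : ℤ) + 1))) =
      Matrix.of fun i j => (e i : ℂ)⁻¹ * Matrix.vandermonde (fun i => (e i : ℂ)⁻¹) i j := by
    ext i j
    rw [Matrix.of_apply, Matrix.of_apply, Matrix.vandermonde_apply, ← pow_succ',
      show -(((j : ℕ) : ℤ) + 1) = -((j + 1 : ℕ) : ℤ) by push_cast; rfl, zpow_neg, zpow_natCast,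
      inv_pow]
  rw [h, Matrix.det_mul_column]
  refine mul_ne_zero (Finset.prod_ne_zero_iff.mpr fun i _ => inv_ne_zero (h0 i))
    (Matrix.det_vandermonde_ne_zero_iff.mpr fun i j hij => ?_)
  exact e.injective (Subtype.ext (inv_injective hij))

/-- The ratio of determinants in terms of the Fredholm determinant. -/
theorem det_betheFun_div (hN : 0 < N) (hNL : N < L)
    (hlabel : ∀ j : Fin N, (N : ℤ) - L ≤ Y j + ((j : ℤ) + 1) ∧ Y j + ((j : ℤ) + 1) ≤ 0)
    (hz0 : z ≠ 0) (hz : ‖z‖ < critRadius N L) (hγ : IsLeftContour N L z γ)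
    (hr0 : 0 < r) (hr : r < density N L) (hY : StrictAnti Y) (e : Fin N ≃ rightRoots N L z) :
    (Matrix.of fun i j : Fin N => betheFun Y j (e i : ℂ)).det /
        (Matrix.of fun i j : Fin N => (e i : ℂ) ^ (-((j : ℤ) + 1))).det =
      (∏ v ∈ rightRoots N L z, ∏ u ∈ leftRoots N L z, (v - u)) /
          ((∏ u ∈ leftRoots N L z, (-u) ^ N) * ∏ v ∈ rightRoots N L z, (v + 1) ^ (L - N)) *
        fredholmDet (energyKernel L Y z γ r) := by
  have hB : ∀ i, -(L : ℤ) ≤ Y i := fun i => by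
    have := (hlabel i).1
    have := i.2
    omega
  have hroot := fun i => ne_zero_of_mem_betheRoots hN hNL hz0 (Finset.mem_filter.mp (e i).2).1
  have hleft : ∏ u ∈ leftRoots N L z, (-u) ^ N ≠ 0 :=
    Finset.prod_ne_zero_iff.mpr fun u hu => pow_ne_zero _ (neg_ne_zero.mpr
      (ne_zero_of_mem_betheRoots hN hNL hz0 (Finset.mem_filter.mp hu).1).1)
  have hright : ∏ i, ((e i : ℂ) + 1) ^ (L - N) ≠ 0 :=
    Finset.prod_ne_zero_iff.mpr fun i _ => pow_ne_zero _ (hroot i).2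
  have hpow : ∏ i, (e i : ℂ) ^ N ≠ 0 :=
    Finset.prod_ne_zero_iff.mpr fun i _ => pow_ne_zero _ (hroot i).1
  have hX := det_pairingMatrix_mul (B := -(L : ℤ)) (Y := Y) hN hNL hz0 hz hr0
    (hr.trans (density_lt_one hNL)) e
  have hE : (Matrix.of fun i j : Fin N => (betheNumer L Y j).eval (e i : ℂ)).det =
      (∏ i, (e i : ℂ) ^ N) * (∏ i, ((e i : ℂ) + 1) ^ (L - N)) *
        (Matrix.of fun i j : Fin N => betheFun Y j (e i : ℂ)).det := by
    rw [← Finset.prod_mul_distrib, ← Matrix.det_mul_column]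
    simp only [eval_betheNumer hNL (hlabel _).1 (hroot _).1 (hroot _).2, Matrix.of_apply]
  -- The Vandermonde determinant from `det_pairingMatrix_mul` is ∏ v_i^N times the energy
  -- denominator; this product cancels the one from ∏ Q(v_i), leaving only the powers of v + 1.
  have hV : (Matrix.of fun i j : Fin N => (e i : ℂ) ^ (N - 1 - (j : ℕ))).det =
      (∏ i, (e i : ℂ) ^ N) *
        (Matrix.of fun i j : Fin N => (e i : ℂ) ^ (-((j : ℤ) + 1))).det := by
    rw [← Matrix.det_mul_column]
    congr 1
    ext i j
    rw [Matrix.of_apply, Matrix.of_apply, Matrix.of_apply, ← zpow_natCast, ← zpow_natCast,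
      ← zpow_add₀ (hroot i).1]
    congr 1
    have := j.2
    omega
  rw [(fredholm_energyKernel hN hNL hlabel hB hz0 hz hγ hr0 hr hY e).2, hE, prod_rightRoots e,
    prod_rightRoots e, div_mul_eq_mul_div, div_eq_div_iff (det_zpow_neg_ne_zero hN hNL hz0 e)
    (mul_ne_zero hleft hright), Finset.prod_pow, ← hX, hV]
  ring

end DualPairing

end PTASEP

end

/-! ### Assembly of the theorem -/

theorem theorem3p7 (N L : ℕ) (hN : 0 < N) (hNL : N < L)
    (Y : Fin N → ℤ) (hY : Y ∈ PTASEP.configSpace N L)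
    (hlabel : ∀ j : Fin N, (N : ℤ) - L ≤ Y j + ((j : ℤ) + 1) ∧ Y j + ((j : ℤ) + 1) ≤ 0)
    (z : ℂ) (hz0 : z ≠ 0) (hz : ‖z‖ < PTASEP.critRadius N L)
    (c : ℂ) (γ : Path c c) (hγ : PTASEP.IsLeftContour N L z γ)
    (r : ℝ) (hr0 : 0 < r) (hr : r < PTASEP.density N L) :
    -- the energy function is well defined and is the ratio of determinants
    (PTASEP.rightRoots N L z).card = N ∧
    (∀ v : Fin N ≃ PTASEP.rightRoots N L z,
      (Matrix.of fun i j : Fin N => (v i : ℂ) ^ (-((j : ℤ) + 1))).det ≠ 0 ∧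
      PTASEP.energy L Y z =
        (Matrix.of fun i j : Fin N =>
            (v i : ℂ) ^ (-((j : ℤ) + 1)) * ((v i : ℂ) + 1) ^ (Y j + ((j : ℤ) + 1))).det /
          (Matrix.of fun i j : Fin N => (v i : ℂ) ^ (-((j : ℤ) + 1))).det) ∧
    -- the expectations, the series and the integrals in the kernel converge
    (∀ v ∈ Metric.sphere (0 : ℂ) r,
      (∀ x : ℤ, MeasureTheory.Integrable (PTASEP.hitWeight (PTASEP.density N L) Y v x)
        (PTASEP.stepLaw (PTASEP.density N L))) ∧
      ∀ t, Summable (PTASEP.chTerm (PTASEP.density N L) Y v (γ t))) ∧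
    (∀ x y : PTASEP.NonposInt,
      (∀ v ∈ Metric.sphere (0 : ℂ) r,
        CurveIntegrable (PTASEP.form (PTASEP.kernelIntegrand L Y z x y v)) γ) ∧
      CircleIntegrable (PTASEP.innerIntegral L Y z γ x y) 0 r) ∧
    -- the Fredholm determinant converges and represents the energy function
    PTASEP.FredholmConverges (PTASEP.energyKernel L Y z γ r) ∧
    PTASEP.energy L Y z =
      (∏ v ∈ PTASEP.rightRoots N L z, ∏ u ∈ PTASEP.leftRoots N L z, (v - u)) /
          ((∏ u ∈ PTASEP.leftRoots N L z, (-u) ^ N) *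
            ∏ v ∈ PTASEP.rightRoots N L z, (v + 1) ^ (L - N)) *
        PTASEP.fredholmDet (PTASEP.energyKernel L Y z γ r) := by
  have hcard := PTASEP.card_rightRoots hN hNL hz0 hz
  have hr1 := hr.trans (PTASEP.density_lt_one hNL)
  -- The lower label bound N - L ≤ y_j + j with j ≤ N makes -L a valid floor for the hitting
  -- recursion.
  have hB : ∀ i, -(L : ℤ) ≤ Y i := fun i => by
    have := (hlabel i).1
    have := i.2
    omega
  have hratio := PTASEP.det_betheFun_div hN hNL hlabel hz0 hz hγ hr0 hr hY.1
  -- The right-hand side of `hratio` does not mention the enumeration. Used once for the enumeration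
  -- chosen in `energy` and once for an arbitrary one, it also gives independence of the order.
  have henergy : PTASEP.energy L Y z = _ := (dif_pos hcard).trans
    (hratio ((PTASEP.rightRoots N L z).equivFinOfCardEq hcard).symm)
  have hkernel := PTASEP.energyKernel_eq hN hNL (fun j => (hlabel j).1) hB hz0 hz hγ hr0 hr hY.1
  refine ⟨hcard, fun v => ⟨PTASEP.det_zpow_neg_ne_zero hN hNL hz0 v,
    henergy.trans (hratio v).symm⟩, fun v hv => ⟨fun x => PTASEP.integrable_hitWeight _ v Y x,
    fun t => ?_⟩, fun x y => ⟨(hkernel x y).1, (hkernel x y).2.1⟩,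
    (PTASEP.fredholm_energyKernel hN hNL hlabel hB hz0 hz hγ hr0 hr hY.1
      ((PTASEP.rightRoots N L z).equivFinOfCardEq hcard).symm).1, henergy⟩
  exact PTASEP.summable_chTerm (PTASEP.density_pos hN hNL) (PTASEP.density_lt_one hNL) hN hB
    (PTASEP.one_add_ne_zero_of_mem_ball (PTASEP.sphere_subset_unit_ball hr1 hv))
    (PTASEP.norm_one_add_lt hr hv (hγ.mem_ball hN hNL t))
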